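/- Let $\mathbf{x}=(x_1,x_2,\dots)$ be a sequence of $N$ variables, where $N\in\{0,1,2,\dots\}\cup\{\infty\}$, and let $\mathbf{a}=(a_k)_{k\in\mathbb{Z}}$ be further variables. For partitions $\mu\subseteq\lambda$, an edge labeled tableau $T$ of shape $\lambda/\mu$ is a semistandard filling of the boxes of $\lambda/\mu$ (English convention; rows weakly and columns strictly increasing) by positive integers $\le N$, together with a set of positive integers $\le N$ on each horizontal edge, only finitely many labels in total, such that every label is strictly greater than the entry of the box of $\lambda/\mu$ directly above its edge and strictly smaller than the entry of the box of $\lambda/\mu$ directly below it (when these boxes exist). The edges which may carry labels are, in each column $j\ge 1$, those lying below row $i$ with $\mu'_j\le i\le\lambda'_j$, where $\lambda'_j,\mu'_j$ are the column lengths and row $0$ is a row of infinite length above the diagram. The weight of $T$ is the product of $x_b$ over all box entries $b$ and of $x_\ell\, a_{c}$ over all edge labels $\ell$, where $c=(\text{column})-(\text{row})$ is the content of the position directly below the edge carrying $\ell$. The edge Schur function is $$E^{\lambda/\mu}(\mathbf{x}|\mathbf{a})=\sum_{T}\mathrm{wt}(T)\in\mathbb{Z}[\![\mathbf{a}]\!][\![\mathbf{x}]\!],$$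 the sum being over all edge labeled tableaux of shape $\lambda/\mu$; set $E^{\lambda/\mu}=0$ if $\mu\not\subseteq\lambda$, and $E^\lambda=E^{\lambda/\emptyset}$. Let $s_{\lambda/\mu}(\mathbf{x})$ be the skew Schur function. Theorem. (1) Each monomial is the weight of only finitely many edge labeled tableaux of shape $\lambda/\mu$, so $E^{\lambda/\mu}$ is well defined. It is invariant under all permutations of the variables $\mathbf{x}$, and the coefficient of each monomial in $\mathbf{a}$ has bounded degree in $\mathbf{x}$; that is, $E^{\lambda/\mu}\in\Lambda[\![\mathbf{a}]\!]$, where $\Lambda$ is the ring of symmetric functions in $\mathbf{x}$ over $\mathbb{Z}$. (2) If $\mu\subseteq\lambda$, then $E^{\lambda/\mu}=s_{\lambda/\mu}+(\text{higher order terms})$, where every monomial $\mathbf{x}^\alpha\mathbf{a}^\beta$ in the higher order terms satisfies $|\beta|>0$ and $|\alpha|=|\lambda|-|\mu|+|\beta|$. (3) The functions $E^\lambda$, over all partitions $\lambda$ of length at most $N$, form a basis of the completed ring of symmetric functions over $\mathbb{Z}[\![\mathbf{a}]\!]$: each monomial in $\mathbf{x}$ occurs in only finitely many $E^\lambda$,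 and every $f\in\mathbb{Z}[\![\mathbf{a}]\!][\![\mathbf{x}]\!]$ that is invariant under all permutations of $\mathbf{x}$ can be written in exactly one way as a (possibly infinite) sum $f=\sum_\lambda c_\lambda E^\lambda$ with $c_\lambda\in\mathbb{Z}[\![\mathbf{a}]\!]$. Moreover $f\in\Lambda[\![\mathbf{a}]\!]$ if and only if each monomial in $\mathbf{a}$ occurs in only finitely many $c_\lambda$. -/

import Mathlib

noncomputable section

namespace EdgeSchur

/-- The ordered alphabet indexing the variables `x_1, x_2, …` : it has `N` letters if `N` is finite,
and it is a copy of the positive integers if `N = ⊤`. The number `i` stands for the letter `i + 1`. -/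
abbrev Alphabet (N : ℕ∞) : Type := {i : ℕ // (i : ℕ∞) < N}

/-- The ring `ℤ⟦a⟧` of formal power series in the variables `a_k`, `k ∈ ℤ`. -/
abbrev ASeries : Type := MvPowerSeries ℤ ℤ

/-- The ring `ℤ⟦a⟧⟦x⟧`, with one variable `x_i` for each letter of the alphabet. -/
abbrev XSeries (N : ℕ∞) : Type := MvPowerSeries (Alphabet N) ASeries

/-- Semistandard tableaux of skew shape `lam / mu` with entries in the ordered alphabet `σ`.
The box `(i, j)` is the one in row `i + 1` and column `j + 1` (English convention). -/
structure SkewTableau (σ : Type) [LinearOrder σ] (lam mu : YoungDiagram) where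
  /-- the entry of each box of the skew shape -/
  entry : ↥(lam.cells \ mu.cells) → σ
  /-- entries weakly increase along rows -/
  row_weak : ∀ b b' : ↥(lam.cells \ mu.cells),
    b.1.1 = b'.1.1 → b.1.2 ≤ b'.1.2 → entry b ≤ entry b'
  /-- entries strictly increase down columns -/
  col_strict : ∀ b b' : ↥(lam.cells \ mu.cells),
    b.1.2 = b'.1.2 → b.1.1 < b'.1.1 → entry b < entry b'

/-- Edge labeled tableaux of shape `lam / mu`. A horizontal edge of the grid is addressed by the
position `(i, j)` of the box whose *upper* edge it is. The edges that may carry labels are the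
horizontal edges of the boxes of `lam / mu` (upper and lower ones), and, in a column without boxes
of `lam / mu`, the bottom edge of that column of `mu` (for an empty column, this is the bottom edge
of a "zeroth row" of infinite length). The element `((i, j), l)` of `labels` says that the label `l`
lies in the set on the edge `(i, j)`; so each edge carries a set of letters, and the total number
of labels is finite. -/
structure EdgeLabeledTableau (σ : Type) [LinearOrder σ] (lam mu : YoungDiagram) extends
    SkewTableau σ lam mu where
  /-- all pairs (edge, label on this edge) -/
  labels : Finset ((ℕ × ℕ) × σ)
  /-- labels sit only on the admissible edges -/
  label_mem : ∀ p ∈ labels, mu.colLen p.1.2 ≤ p.1.1 ∧ p.1.1 ≤ lam.colLen p.1.2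
  /-- a label is strictly greater than the entry of the box above its edge -/
  above_lt : ∀ (b : ↥(lam.cells \ mu.cells)) (l : σ),
    ((b.1.1 + 1, b.1.2), l) ∈ labels → entry b < l
  /-- a label is strictly smaller than the entry of the box below its edge -/
  lt_below : ∀ (b : ↥(lam.cells \ mu.cells)) (l : σ),
    ((b.1.1, b.1.2), l) ∈ labels → l < entry b

variable {σ : Type} [LinearOrder σ] {lam mu : YoungDiagram}

/-- The exponent of the monomial `∏ x_b` over the entries `b` of a semistandard tableau. -/
def SkewTableau.xExp (T : SkewTableau σ lam mu) : σ →₀ ℕ :=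
  ∑ b, Finsupp.single (T.entry b) 1

/-- The exponent of `x` in the weight: one factor `x_b` for each entry `b` of a box and one factor
`x_l` for each edge label `l`. -/
def EdgeLabeledTableau.xExp (T : EdgeLabeledTableau σ lam mu) : σ →₀ ℕ :=
  T.toSkewTableau.xExp + ∑ p ∈ T.labels, Finsupp.single p.2 1

/-- The exponent of `a` in the weight: one factor `a_c` for each edge label, where `c = j - i` is the
content of the position `(i, j)` directly below its edge. -/
def EdgeLabeledTableau.aExp (T : EdgeLabeledTableau σ lam mu) : ℤ →₀ ℕ :=
  ∑ p ∈ T.labels, Finsupp.single ((p.1.2 : ℤ) - (p.1.1 : ℤ)) 1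

/-- The set of edge labeled tableaux with weight `x ^ α * a ^ β`. -/
def tableauxOfWeight (lam mu : YoungDiagram) (α : σ →₀ ℕ) (β : ℤ →₀ ℕ) :
    Set (EdgeLabeledTableau σ lam mu) :=
  {T | T.xExp = α ∧ T.aExp = β}

open Classical in
/-- The edge Schur function `E^{lam/mu}(x|a)` in `N` variables `x` (infinitely many if `N = ⊤`):
the generating series of edge labeled tableaux of shape `lam / mu`, and `0` unless `mu ⊆ lam`. -/
def edgeSchur (N : ℕ∞) (lam mu : YoungDiagram) : XSeries N :=
  if mu ≤ lam then fun α β =>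
    ((tableauxOfWeight (σ := Alphabet N) lam mu α β).ncard : ℤ)
  else 0

open Classical in
/-- The skew Schur function `s_{lam/mu}(x)` in `N` variables, with integer coefficients: the
generating series of semistandard tableaux of shape `lam / mu`, and `0` unless `mu ⊆ lam`. -/
def skewSchur (N : ℕ∞) (lam mu : YoungDiagram) : MvPowerSeries (Alphabet N) ℤ :=
  if mu ≤ lam then fun α =>
    (({T | T.xExp = α} : Set (SkewTableau (Alphabet N) lam mu)).ncard : ℤ)
  else 0

/-- Invariance under all permutations of the variables `x`. -/
def IsSymmetricX {N : ℕ∞} (f : XSeries N) : Prop :=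
  ∀ e : Equiv.Perm (Alphabet N), MvPowerSeries.rename e f = f

/-- For each monomial `a ^ β`, the coefficient of `a ^ β` in `f` is a series in `x` of bounded
degree. For symmetric `f`, this says that these coefficients are symmetric functions in the usual
sense, i.e. that `f` lies in `Λ⟦a⟧`. -/
def HasBoundedDegreeX {N : ℕ∞} (f : XSeries N) : Prop :=
  ∀ β : ℤ →₀ ℕ, ∃ d : ℕ, ∀ α : Alphabet N →₀ ℕ, (f.coeff α).coeff β ≠ 0 → α.degree ≤ d

/-- Partitions of length at most `N`. -/
abbrev PartitionOfLength (N : ℕ∞) : Type := {lam : YoungDiagram // (lam.colLen 0 : ℕ∞) ≤ N}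

/-- `f = ∑ c_lam * E^lam`, the sum being taken coefficientwise in `x`, with only finitely many
nonzero terms in each coefficient. -/
def IsExpansion {N : ℕ∞} (c : PartitionOfLength N → ASeries) (f : XSeries N) : Prop :=
  ∀ α : Alphabet N →₀ ℕ,
    {lam : PartitionOfLength N | c lam * (edgeSchur N lam.1 ⊥).coeff α ≠ 0}.Finite ∧
      f.coeff α = ∑ᶠ lam : PartitionOfLength N, c lam * (edgeSchur N lam.1 ⊥).coeff α

end EdgeSchur

end

noncomputable section

namespace EdgeSchur

open Finset

/-! Symmetry comes from commuting transfer matrices. In a tableau of shape `lam / mu` the boxes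
holding the smallest letter `x` form a horizontal strip `nu / mu`, and that letter can be an edge
label only in a column without a box of the strip, on the bottom edge of `mu`. The contribution of
`x` is therefore the product `stripWeight` of column factors: `x` for a column with a box, `1 + x *
a_c` for one without. Iterating, the generating function is a sum over chains of diagrams from `mu`
to `lam` (`tableauxSum_eq_chainSum`), a matrix entry of a product with one factor per letter. It
remains to see that two factors commute (`sum_stripWeight_mul_comm`). For fixed `mu` and `kap`, the
intermediate `nu` is given by independent choices of row lengths. Each row then contributes a sum
over the position of the boundary between its two letters, which is symmetric in them
(`boundarySum_comm`).

With infinitely many columns or letters these sums are infinite, so everything is done for finitely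
many letters and for labels in the first `M` columns. A fixed monomial involves finitely many
letters, and its `a`-exponent bounds the contents, hence the columns, of its labels. So each
coefficient is seen by a truncation (`coeff_tableauxSum`). The shape of the expansion in part (2) is
a count of boxes and labels.

For the basis, give the `i`-th letter weight `i`. Column strictness forces every entry to be at
least its row index, so any monomial of `E^mu` has weight at least `rowSum mu`, with equality only
for the superstandard tableau. Hence the coefficients of the `E^mu` at the dominant monomials
`x^lam` form a unitriangular matrix with finitely many possible entries below each diagram. A
symmetric series is determined by its dominant coefficients (`IsSymmetricX.ext_rowExp`), so
expansions exist and are unique by recursion on `rowSum`. Boundedness of degree is compared on the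
two sides through `|α| = |lam| + |β|`. -/

/-! ### Young diagrams via row and column lengths. -/

theorem lt_rowLen_iff (lam : YoungDiagram) (i j : ℕ) : j < lam.rowLen i ↔ i < lam.colLen j := by
  rw [← YoungDiagram.mem_iff_lt_rowLen, YoungDiagram.mem_iff_lt_colLen]

theorem colLen_mono {mu lam : YoungDiagram} (h : mu ≤ lam) (j : ℕ) :
    mu.colLen j ≤ lam.colLen j := by
  by_contra! hlt
  have := h (YoungDiagram.mem_iff_lt_colLen.2 hlt)
  exact lt_irrefl _ (YoungDiagram.mem_iff_lt_colLen.1 this)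

theorem le_of_colLen_le {mu lam : YoungDiagram} (h : ∀ j, mu.colLen j ≤ lam.colLen j) :
    mu ≤ lam := by
  rintro ⟨i, j⟩ hij
  exact YoungDiagram.mem_iff_lt_colLen.2 ((YoungDiagram.mem_iff_lt_colLen.1 hij).trans_le (h j))

/-- A finite set of cells contains only finitely many Young diagrams. -/
theorem finite_cells_subset (s : Finset (ℕ × ℕ)) : {nu : YoungDiagram | nu.cells ⊆ s}.Finite := by
  refine Set.Finite.of_finite_image (f := YoungDiagram.cells)
    ((Finset.finite_toSet s.powerset).subset ?_) ?_
  · rintro _ ⟨nu, hnu, rfl⟩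
    simpa using hnu
  · intro nu _ nu' _ h
    exact YoungDiagram.ext h

/-- The finite set of Young diagrams contained in `lam`. -/
def subdiagrams (lam : YoungDiagram) : Finset YoungDiagram :=
  (finite_cells_subset lam.cells).toFinset

@[simp]
theorem mem_subdiagrams {lam nu : YoungDiagram} : nu ∈ subdiagrams lam ↔ nu ≤ lam := by
  simp [subdiagrams]

/-- The Young diagram whose first `R` rows have lengths `r 0 ≥ r 1 ≥ …`. -/
def ofRows (R : ℕ) (r : ℕ → ℕ) (hr : ∀ i i', i ≤ i' → i' < R → r i' ≤ r i) : YoungDiagram where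
  cells := (range R).biUnion fun i => (range (r i)).image fun j => (i, j)
  isLowerSet := by
    rintro ⟨i, j⟩ ⟨i', j'⟩ hle hmem
    simp only [coe_biUnion, coe_range, Set.mem_Iio, coe_image, Set.mem_iUnion, Set.mem_image,
      Prod.mk.injEq, exists_prop] at hmem ⊢
    obtain ⟨k, hk, l, hl, rfl, rfl⟩ := hmem
    have h1 : i' ≤ k := hle.1
    have h2 : j' ≤ l := hle.2
    exact ⟨i', by omega, j', by have := hr i' k h1 hk; omega, rfl, rfl⟩

@[simp]
theorem mem_ofRows {R : ℕ} {r : ℕ → ℕ} {hr : ∀ i i', i ≤ i' → i' < R → r i' ≤ r i} {i j : ℕ} :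
    (i, j) ∈ ofRows R r hr ↔ i < R ∧ j < r i := by
  rw [← YoungDiagram.mem_cells]
  simp [ofRows]

/-! ### The two-letter exchange identity and the weight of a horizontal strip. -/

section Strip

variable {R : Type*} [CommRing R]

/-- The two-variable sum over the possible positions of the boundary between the two letters in
`k` consecutive free columns of a row. -/
def boundarySum (b : ℕ → R) (k : ℕ) (x y : R) : R :=
  ∑ r ∈ range (k + 1), ∏ j ∈ range k,
    if j < r then x * (1 + y * b j) else y * (1 + x * b (j + 1))

theorem boundarySum_succ (b : ℕ → R) (k : ℕ) (x y : R) :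
    boundarySum b (k + 1) x y =
      boundarySum b k x y * (y * (1 + x * b (k + 1))) +
        ∏ j ∈ range (k + 1), (x * (1 + y * b j)) := by
  unfold boundarySum
  rw [sum_range_succ, sum_mul]
  congr 1
  · refine sum_congr rfl fun r hr => ?_
    rw [prod_range_succ, if_neg (by simp at hr; omega)]
  · refine prod_congr rfl fun j hj => ?_
    rw [if_pos (by simpa using hj)]

/-- Telescoping: `x * (1 + y * b) - y * (1 + x * b) = x - y` for every `b`, so each induction step
replaces one factor. The right side is visibly antisymmetric in `x` and `y`. -/
theorem sub_mul_boundarySum (b : ℕ → R) (k : ℕ) (x y : R) :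
    (x - y) * boundarySum b k x y =
      ∏ j ∈ range (k + 1), (x * (1 + y * b j)) - ∏ j ∈ range (k + 1), (y * (1 + x * b j)) := by
  induction k with
  | zero => simp [boundarySum]; ring
  | succ k ih =>
    rw [boundarySum_succ, mul_add, ← mul_assoc, ih, prod_range_succ _ (k + 1),
      prod_range_succ _ (k + 1)]
    ring

/-- In a general ring `x - y` cannot be cancelled from `sub_mul_boundarySum`. In the induction step,
however, the two sides differ exactly by that identity for `k`. -/
theorem boundarySum_comm (b : ℕ → R) (k : ℕ) (x y : R) :
    boundarySum b k x y = boundarySum b k y x := by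
  induction k with
  | zero => simp [boundarySum]
  | succ k ih =>
    have h := sub_mul_boundarySum b k x y
    rw [boundarySum_succ, boundarySum_succ, ← ih]
    linear_combination -h

theorem sum_boundary_comm (b : ℕ → R) (lo hi : ℕ) (x y : R) :
    (∑ r ∈ Icc lo hi, ∏ j ∈ Ico lo hi,
      if j < r then x * (1 + y * b j) else y * (1 + x * b (j + 1))) =
    ∑ r ∈ Icc lo hi, ∏ j ∈ Ico lo hi,
      if j < r then y * (1 + x * b j) else x * (1 + y * b (j + 1)) := by
  rcases le_or_gt lo hi with h | h
  swap
  · simp [Icc_eq_empty (not_le.2 h)]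
  obtain ⟨k, rfl⟩ := Nat.exists_eq_add_of_le h
  have key : ∀ x y : R, (∑ r ∈ Icc lo (lo + k), ∏ j ∈ Ico lo (lo + k),
      if j < r then x * (1 + y * b j) else y * (1 + x * b (j + 1))) =
      boundarySum (fun j => b (lo + j)) k x y := by
    intro x y
    rw [boundarySum, show Icc lo (lo + k) = Ico lo (lo + (k + 1)) by ext; simp; omega,
      sum_Ico_eq_sum_range]
    simp only [Nat.add_sub_cancel_left]
    refine sum_congr rfl fun r _ => ?_
    rw [prod_Ico_eq_prod_range, Nat.add_sub_cancel_left]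
    refine prod_congr rfl fun j _ => ?_
    simp [add_assoc]
  rw [key, key, boundarySum_comm]

/-- The weight of column `j` when a single letter `x` raises its length from `m` to `n`. -/
def colWeight (a : ℤ → R) (x : R) (j m n : ℕ) : R :=
  if n = m then 1 + x * a ((j : ℤ) - m) else if n = m + 1 then x else 0

/-- The generating function of one-letter edge labeled tableaux of shape `nu / mu`, with labels in
the first `M` columns only. -/
def stripWeight (a : ℤ → R) (M : ℕ) (x : R) (mu nu : YoungDiagram) : R :=
  ∏ j ∈ range M, colWeight a x j (mu.colLen j) (nu.colLen j)

/-- `nu / mu` has at most one box in each column. -/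
def IsStrip (mu nu : YoungDiagram) : Prop :=
  ∀ j, mu.colLen j ≤ nu.colLen j ∧ nu.colLen j ≤ mu.colLen j + 1

theorem colLen_eq_zero {lam nu : YoungDiagram} {M j : ℕ} (hM : lam.rowLen 0 ≤ M) (h : nu ≤ lam)
    (hj : M ≤ j) : nu.colLen j = 0 := by
  have := colLen_mono h j
  have h2 : ¬ 0 < lam.colLen j := by rw [← lt_rowLen_iff]; omega
  omega

theorem stripWeight_eq_zero {a : ℤ → R} {M : ℕ} {x : R} {lam mu nu : YoungDiagram}
    (hM : lam.rowLen 0 ≤ M) (hmu : mu ≤ lam) (hnu : nu ≤ lam) (h : ¬ IsStrip mu nu) :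
    stripWeight a M x mu nu = 0 := by
  unfold IsStrip at h
  push Not at h
  obtain ⟨j, hj⟩ := h
  refine prod_eq_zero (i := j) ?_ ?_
  · by_contra hjM
    have h1 := colLen_eq_zero hM hmu (j := j) (by simpa using hjM)
    have h2 := colLen_eq_zero hM hnu (j := j) (by simpa using hjM)
    omega
  · unfold colWeight
    rw [if_neg (by omega), if_neg (by omega)]

end Strip

/-! ### Horizontal strips as interlacing row lengths. -/

theorem rowLen_mono {mu lam : YoungDiagram} (h : mu ≤ lam) (i : ℕ) :
    mu.rowLen i ≤ lam.rowLen i := by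
  by_contra! hlt
  have := h (YoungDiagram.mem_iff_lt_rowLen.2 hlt)
  exact lt_irrefl _ (YoungDiagram.mem_iff_lt_rowLen.1 this)

theorem rowLen_eq_of_mem_iff {lam : YoungDiagram} {i n : ℕ} (h : ∀ j, (i, j) ∈ lam ↔ j < n) :
    lam.rowLen i = n := by
  refine le_antisymm ?_ ?_
  · by_contra! hlt
    exact lt_irrefl _ ((h n).1 (YoungDiagram.mem_iff_lt_rowLen.2 hlt))
  · by_contra! hlt
    exact lt_irrefl _ (YoungDiagram.mem_iff_lt_rowLen.1 ((h _).2 hlt))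

theorem isStrip_iff_rowLen {mu nu : YoungDiagram} :
    IsStrip mu nu ↔ ∀ i, mu.rowLen i ≤ nu.rowLen i ∧ nu.rowLen (i + 1) ≤ mu.rowLen i := by
  constructor
  · intro h i
    constructor <;> by_contra! hlt
    · have h1 := (lt_rowLen_iff mu i _).1 hlt
      have h2 := (lt_rowLen_iff nu i (nu.rowLen i)).2 (h1.trans_le (h _).1)
      omega
    · have h1 := (lt_rowLen_iff nu (i + 1) _).1 hlt
      have h3 := (h (mu.rowLen i)).2
      have h2 := (lt_rowLen_iff mu i (mu.rowLen i)).2 (by omega)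
      omega
  · intro h j
    constructor <;> by_contra! hlt
    · have h1 := (lt_rowLen_iff mu _ j).2 hlt
      have h2 := (lt_rowLen_iff nu (nu.colLen j) j).1 (h1.trans_le (h _).1)
      omega
    · have h1 := (lt_rowLen_iff nu _ j).2 hlt
      have h2 := (lt_rowLen_iff mu (mu.colLen j) j).1 (h1.trans_le (h _).2)
      omega

/-- The smallest possible length of row `i` of a diagram `nu` such that `nu / mu` and `kap / nu`
are horizontal strips. -/
def rowLo (mu kap : YoungDiagram) (i : ℕ) : ℕ := max (mu.rowLen i) (kap.rowLen (i + 1))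

/-- The largest possible length of row `i` of a diagram `nu` such that `nu / mu` and `kap / nu`
are horizontal strips. -/
def rowHi (mu kap : YoungDiagram) (i : ℕ) : ℕ :=
  if i = 0 then kap.rowLen 0 else min (kap.rowLen i) (mu.rowLen (i - 1))

theorem rowLen_mem_Icc {mu nu kap : YoungDiagram} (h : IsStrip mu nu) (h' : IsStrip nu kap)
    (i : ℕ) : nu.rowLen i ∈ Icc (rowLo mu kap i) (rowHi mu kap i) := by
  rw [isStrip_iff_rowLen] at h h'
  rw [mem_Icc, rowLo, rowHi]
  refine ⟨max_le (h i).1 (h' i).2, ?_⟩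
  split_ifs with hi
  · subst hi; exact (h' 0).1
  · obtain ⟨k, rfl⟩ := Nat.exists_eq_succ_of_ne_zero hi
    exact le_min (h' _).1 (h k).2

/-- The interval of freedom of row `i` consists of the columns whose only box of `kap / mu` lies in
row `i`; such a box may carry either of the two letters. -/
theorem mem_Ico_rowLo_rowHi {mu kap : YoungDiagram} {i j : ℕ} :
    j ∈ Ico (rowLo mu kap i) (rowHi mu kap i) ↔ mu.colLen j = i ∧ kap.colLen j = i + 1 := by
  have h1 := lt_rowLen_iff mu i j
  have h2 := lt_rowLen_iff kap (i + 1) j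
  have h3 := lt_rowLen_iff kap i j
  rw [mem_Ico, rowLo, rowHi]
  split_ifs with hi
  · subst hi
    omega
  · have h4 := lt_rowLen_iff mu (i - 1) j
    omega

/-! ### Commutation of the one-letter transfer matrices. -/

section Strip

variable {R : Type*} [CommRing R]

/-- The factor of a free column. -/
def freeWeight (a : ℤ → R) (x y : R) (i j r : ℕ) : R :=
  if j < r then x * (1 + y * a ((j : ℤ) - i - 1)) else y * (1 + x * a ((j : ℤ) - i))

/-- The factor of a column in which the letters of the boxes are determined by the shape. -/
def fixedWeight (a : ℤ → R) (x y : R) (j m n : ℕ) : R :=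
  if n = m then (1 + x * a ((j : ℤ) - m)) * (1 + y * a ((j : ℤ) - m)) else x * y

/-- A column with zero or two boxes of `kap / mu` leaves no choice for `nu`. The columns with one
box are grouped by the row of that box; within row `i`, whether the box belongs to `nu` depends only
on the length of row `i` of `nu`. -/
theorem stripWeight_mul {a : ℤ → R} {M : ℕ} {x y : R} {mu nu kap lam : YoungDiagram}
    (hM : lam.rowLen 0 ≤ M) (hkap : kap ≤ lam) (h : IsStrip mu nu) (h' : IsStrip nu kap) :
    stripWeight a M x mu nu * stripWeight a M y nu kap =
      (∏ j ∈ range M with ¬ kap.colLen j = mu.colLen j + 1,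
        fixedWeight a x y j (mu.colLen j) (kap.colLen j)) *
      ∏ i : Fin (lam.colLen 0), ∏ j ∈ Ico (rowLo mu kap i) (rowHi mu kap i),
        freeWeight a x y i j (nu.rowLen i) := by
  classical
  rw [stripWeight, stripWeight, ← prod_mul_distrib,
    ← prod_filter_mul_prod_filter_not (range M) (fun j => kap.colLen j = mu.colLen j + 1), mul_comm]
  congr 1
  · refine prod_congr rfl fun j hj => ?_
    have h1 := h j
    have h2 := h' j
    have h3 := (mem_filter.1 hj).2
    unfold colWeight fixedWeight
    by_cases hk : kap.colLen j = mu.colLen j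
    · have : nu.colLen j = mu.colLen j := by omega
      simp [hk, this]
    · have e1 : nu.colLen j = mu.colLen j + 1 := by omega
      have e2 : kap.colLen j = nu.colLen j + 1 := by omega
      rw [if_neg (by omega), if_pos e1, if_neg (by omega), if_pos e2, if_neg hk]
  · rw [← Finset.prod_range (fun i => ∏ j ∈ Ico (rowLo mu kap i) (rowHi mu kap i),
        freeWeight a x y i j (nu.rowLen i)),
      ← prod_fiberwise_of_maps_to (s := {j ∈ range M | kap.colLen j = mu.colLen j + 1})
        (t := range (lam.colLen 0)) (g := fun j => mu.colLen j)]
    · refine prod_congr rfl fun i hi => ?_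
      have hset : ({j ∈ {j ∈ range M | kap.colLen j = mu.colLen j + 1} | mu.colLen j = i}) =
          Ico (rowLo mu kap i) (rowHi mu kap i) := by
        ext j
        rw [mem_Ico_rowLo_rowHi]
        simp only [mem_filter, mem_range]
        constructor
        · rintro ⟨⟨_, h1⟩, h2⟩; exact ⟨h2, by omega⟩
        · rintro ⟨h1, h2⟩
          refine ⟨⟨?_, by omega⟩, h1⟩
          exact ((lt_rowLen_iff lam 0 j).2 (by have := colLen_mono hkap j; omega)).trans_le hM
      rw [hset]
      refine prod_congr rfl fun j hj => ?_
      obtain ⟨h1, h2⟩ := mem_Ico_rowLo_rowHi.1 hj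
      have h3 := h j
      have h4 := h' j
      have h5 := lt_rowLen_iff nu i j
      unfold colWeight freeWeight
      rw [h1, h2]
      by_cases hn : nu.colLen j = i
      · rw [if_pos hn, if_neg (by omega), if_pos (by omega), if_neg (by omega)]
        ring
      · have hn' : nu.colLen j = i + 1 := by omega
        rw [if_neg (by omega), if_pos hn', if_pos (by omega), if_pos (by omega), hn']
        push_cast
        rw [sub_sub]
    · intro j hj
      have h1 := (mem_filter.1 hj).2
      have h2 := lam.colLen_anti 0 j (Nat.zero_le _)
      have h3 := colLen_mono hkap j
      simp only [mem_range]
      omega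

/-- The interlacing conditions constrain each row of `nu` separately, and any choice of rows within
the bounds is automatically a partition, so the sum over `nu` factors over rows. -/
theorem sum_isStrip_eq_prod {mu kap lam : YoungDiagram}
    [DecidablePred fun nu => IsStrip mu nu ∧ IsStrip nu kap] (hmu : mu ≤ lam)
    (hkap : kap ≤ lam) (g : ℕ → ℕ → R) :
    ∑ nu ∈ subdiagrams lam with IsStrip mu nu ∧ IsStrip nu kap,
        ∏ i : Fin (lam.colLen 0), g i (nu.rowLen i) =
      ∏ i : Fin (lam.colLen 0), ∑ r ∈ Icc (rowLo mu kap i) (rowHi mu kap i), g i r := by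
  classical
  rw [prod_univ_sum]
  have hlam : ∀ i, lam.colLen 0 ≤ i → lam.rowLen i = 0 := by
    intro i hi
    have h2 := lt_rowLen_iff lam i 0
    omega
  have hmu0 : ∀ i, lam.colLen 0 ≤ i → mu.rowLen i = 0 := fun i hi =>
    Nat.eq_zero_of_le_zero ((rowLen_mono hmu i).trans (hlam i hi).le)
  have hkap0 : ∀ i, lam.colLen 0 ≤ i → kap.rowLen i = 0 := fun i hi =>
    Nat.eq_zero_of_le_zero ((rowLen_mono hkap i).trans (hlam i hi).le)
  have hzero : ∀ nu, IsStrip nu kap → ∀ i, lam.colLen 0 ≤ i → nu.rowLen i = 0 := fun nu h i hi =>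
    Nat.eq_zero_of_le_zero (((isStrip_iff_rowLen.1 h) i).1.trans (hkap0 i hi).le)
  refine sum_bij (fun nu _ i => nu.rowLen i) ?_ ?_ ?_ ?_
  · intro nu hnu
    obtain ⟨-, h, h'⟩ := mem_filter.1 hnu
    exact Fintype.mem_piFinset.2 fun i => rowLen_mem_Icc h h' i
  · intro nu hnu nu' hnu' heq
    obtain ⟨-, h, h'⟩ := mem_filter.1 hnu
    obtain ⟨-, k, k'⟩ := mem_filter.1 hnu'
    refine SetLike.ext ?_
    rintro ⟨i, j⟩
    rw [YoungDiagram.mem_iff_lt_rowLen, YoungDiagram.mem_iff_lt_rowLen]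
    rcases lt_or_ge i (lam.colLen 0) with hi | hi
    · have := congrFun heq ⟨i, hi⟩
      simp only at this
      rw [this]
    · rw [hzero nu h' i hi, hzero nu' k' i hi]
  · intro r hr
    have hr' : ∀ i (hi : i < lam.colLen 0), max (mu.rowLen i) (kap.rowLen (i + 1)) ≤ r ⟨i, hi⟩ ∧
        r ⟨i, hi⟩ ≤ rowHi mu kap i := fun i hi => by
      simpa [rowLo] using Fintype.mem_piFinset.1 hr ⟨i, hi⟩
    set r' : ℕ → ℕ := fun i => if hi : i < lam.colLen 0 then r ⟨i, hi⟩ else 0 with hr'def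
    have hpos : ∀ i (hi : i < lam.colLen 0), r' i = r ⟨i, hi⟩ := fun i hi => dif_pos hi
    have hneg : ∀ i, lam.colLen 0 ≤ i → r' i = 0 := fun i hi => dif_neg (not_lt.2 hi)
    have e1 : ∀ i, mu.rowLen i ≤ r' i ∧ kap.rowLen (i + 1) ≤ r' i ∧ r' i ≤ rowHi mu kap i := by
      intro i
      rcases lt_or_ge i (lam.colLen 0) with hi | hi
      · have := hr' i hi
        rw [hpos i hi]
        omega
      · rw [hneg i hi, hmu0 i hi, hkap0 (i + 1) (by omega)]
        omega
    have e2 : ∀ i, r' i ≤ kap.rowLen i ∧ r' (i + 1) ≤ mu.rowLen i := by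
      intro i
      have h1 := (e1 i).2.2
      have h2 := (e1 (i + 1)).2.2
      rw [rowHi] at h1 h2
      rw [if_neg (by omega), Nat.add_sub_cancel] at h2
      refine ⟨?_, by omega⟩
      split_ifs at h1 with hi
      · rwa [hi] at h1 ⊢
      · omega
    -- Consecutive rows are separated by a row of `mu`: `r' (i + 1) ≤ mu.rowLen i ≤ r' i`.
    have hanti : Antitone r' := antitone_nat_of_succ_le fun i => (e2 i).2.trans (e1 i).1
    have hrow : ∀ i, (ofRows (lam.colLen 0) r' fun i i' h _ => hanti h).rowLen i = r' i := by
      intro i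
      refine rowLen_eq_of_mem_iff fun j => ?_
      rw [mem_ofRows]
      refine ⟨fun h => h.2, fun h => ⟨?_, h⟩⟩
      by_contra! hi
      rw [hneg i hi] at h
      omega
    refine ⟨ofRows (lam.colLen 0) r' fun i i' h _ => hanti h, ?_, ?_⟩
    · rw [mem_filter, mem_subdiagrams, isStrip_iff_rowLen, isStrip_iff_rowLen]
      simp only [hrow]
      refine ⟨le_trans ?_ hkap, fun i => ⟨(e1 i).1, (e2 i).2⟩, fun i => ⟨(e2 i).1, (e1 i).2.1⟩⟩
      rintro ⟨i, j⟩ hij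
      rw [YoungDiagram.mem_iff_lt_rowLen, hrow] at hij
      exact YoungDiagram.mem_iff_lt_rowLen.2 (hij.trans_le (e2 i).1)
    · funext i
      rw [hrow, hpos i i.2]
  · intro nu _
    rfl

theorem sum_stripWeight_mul_comm (a : ℤ → R) {M : ℕ} (x y : R) {lam mu kap : YoungDiagram}
    (hM : lam.rowLen 0 ≤ M) (hmu : mu ≤ lam) (hkap : kap ≤ lam) :
    ∑ nu ∈ subdiagrams lam, stripWeight a M x mu nu * stripWeight a M y nu kap =
      ∑ nu ∈ subdiagrams lam, stripWeight a M y mu nu * stripWeight a M x nu kap := by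
  classical
  have key : ∀ x y : R,
      ∑ nu ∈ subdiagrams lam, stripWeight a M x mu nu * stripWeight a M y nu kap =
      (∏ j ∈ range M with ¬ kap.colLen j = mu.colLen j + 1,
        fixedWeight a x y j (mu.colLen j) (kap.colLen j)) *
      ∏ i : Fin (lam.colLen 0), ∑ r ∈ Icc (rowLo mu kap i) (rowHi mu kap i),
        ∏ j ∈ Ico (rowLo mu kap i) (rowHi mu kap i), freeWeight a x y i j r := by
    intro x y
    rw [← sum_isStrip_eq_prod hmu hkap (fun i r => ∏ j ∈ Ico (rowLo mu kap i) (rowHi mu kap i),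
      freeWeight a x y i j r), mul_sum,
      ← sum_filter_of_ne (p := fun nu => IsStrip mu nu ∧ IsStrip nu kap)]
    · refine sum_congr rfl fun nu hnu => ?_
      obtain ⟨-, h, h'⟩ := mem_filter.1 hnu
      exact stripWeight_mul hM hkap h h'
    · intro nu hnu hne
      rw [mem_subdiagrams] at hnu
      by_contra hcon
      rw [not_and_or] at hcon
      rcases hcon with h | h
      · exact hne (by rw [stripWeight_eq_zero hM hmu hnu h, zero_mul])
      · exact hne (by rw [stripWeight_eq_zero hM hnu hkap h, mul_zero])
  rw [key, key]
  congr 1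
  · refine prod_congr rfl fun j _ => ?_
    unfold fixedWeight
    split_ifs <;> ring
  · refine prod_congr rfl fun i _ => ?_
    -- A label below the box in row `i` has content `j - i - 1` and a label above it has content `j
    -- - i`, the value of the same sequence one step later. This is the shift from `b j` to `b (j +
    -- 1)` in the exchange identity.
    have := sum_boundary_comm (fun j => a ((j : ℤ) - i - 1)) (rowLo mu kap i) (rowHi mu kap i) x y
    simpa [freeWeight, sub_right_comm, add_sub_right_comm] using this

end Strip

/-! ### Sums over chains of diagrams, invariant under reordering the variables. -/

section Chain

variable {R R' : Type*} [CommRing R] [CommRing R']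

/-- The sum over all chains of diagrams from `mu` to `lam` of the products of strip weights, with
one step for each variable in the list. -/
def chainSum (a : ℤ → R) (M : ℕ) (lam : YoungDiagram) : List R → YoungDiagram → R
  | [], mu => open Classical in if mu = lam then 1 else 0
  | x :: xs, mu =>
    ∑ nu ∈ subdiagrams lam, stripWeight a M x mu nu * chainSum a M lam xs nu

/-- Permutations are generated by swaps of neighbouring variables, and such a swap is the
commutation of two transfer matrices. -/
theorem chainSum_perm (a : ℤ → R) {M : ℕ} {lam : YoungDiagram} (hM : lam.rowLen 0 ≤ M)
    {xs ys : List R} (h : xs.Perm ys) :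
    ∀ mu ≤ lam, chainSum a M lam xs mu = chainSum a M lam ys mu := by
  induction h with
  | nil => intro mu _; rfl
  | cons x _ ih =>
    intro mu hmu
    exact sum_congr rfl fun nu hnu => by rw [ih nu (mem_subdiagrams.1 hnu)]
  | swap x y l =>
    intro mu hmu
    have key : ∀ x y : R, chainSum a M lam (x :: y :: l) mu =
        ∑ kap ∈ subdiagrams lam,
          (∑ nu ∈ subdiagrams lam, stripWeight a M x mu nu * stripWeight a M y nu kap) *
            chainSum a M lam l kap := by
      intro x y
      simp only [chainSum, mul_sum, sum_mul]
      rw [sum_comm]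
      simp only [mul_assoc]
    rw [key, key]
    refine sum_congr rfl fun kap hkap => ?_
    rw [sum_stripWeight_mul_comm a x y hM hmu (mem_subdiagrams.1 hkap)]
  | trans _ _ ih₁ ih₂ => intro mu hmu; rw [ih₁ mu hmu, ih₂ mu hmu]

theorem map_stripWeight (f : R →+* R') (a : ℤ → R) (M : ℕ) (x : R) (mu nu : YoungDiagram) :
    f (stripWeight a M x mu nu) = stripWeight (fun c => f (a c)) M (f x) mu nu := by
  rw [stripWeight, stripWeight, map_prod]
  refine prod_congr rfl fun j _ => ?_
  unfold colWeight
  split_ifs <;> simp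

theorem map_chainSum (f : R →+* R') (a : ℤ → R) (M : ℕ) (lam : YoungDiagram) (xs : List R) :
    ∀ mu, f (chainSum a M lam xs mu) = chainSum (fun c => f (a c)) M lam (xs.map f) mu := by
  induction xs with
  | nil =>
    intro mu
    simp only [chainSum, List.map_nil]
    split_ifs <;> simp
  | cons x xs ih =>
    intro mu
    simp only [chainSum, List.map_cons, map_sum, map_mul, ih, map_stripWeight]

end Chain

/-! ### Truncated generating functions of edge labeled tableaux. -/

section Tableaux

variable {σ : Type} [LinearOrder σ] {lam mu nu : YoungDiagram}

theorem SkewTableau.ext_entry {T T' : SkewTableau σ lam mu} (h : ∀ b, T.entry b = T'.entry b) :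
    T = T' := by
  cases T; cases T'
  congr
  exact funext h

theorem EdgeLabeledTableau.ext_entry_labels {T T' : EdgeLabeledTableau σ lam mu}
    (h : ∀ b, T.entry b = T'.entry b) (h' : T.labels = T'.labels) : T = T' := by
  have h1 : T.toSkewTableau = T'.toSkewTableau := SkewTableau.ext_entry h
  cases T; cases T'
  simp only at h1 h'
  subst h1 h'
  rfl

theorem finite_tableaux (S : Finset σ) (L : Finset ((ℕ × ℕ) × σ)) :
    {T : EdgeLabeledTableau σ lam mu | (∀ b, T.entry b ∈ S) ∧ T.labels ⊆ L}.Finite := by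
  refine Set.Finite.of_finite_image
    (f := fun T : EdgeLabeledTableau σ lam mu => (T.entry, T.labels))
    ((((Fintype.piFinset fun _ => S) ×ˢ L.powerset).finite_toSet).subset ?_) ?_
  · rintro _ ⟨T, ⟨h1, h2⟩, rfl⟩
    simp only [coe_product, Set.mem_prod, mem_coe, Fintype.mem_piFinset, mem_powerset]
    exact ⟨h1, h2⟩
  · intro T _ T' _ h
    simp only [Prod.mk.injEq] at h
    exact EdgeLabeledTableau.ext_entry_labels (congrFun h.1) h.2

theorem finite_boundedTableaux (S : Finset σ) (M : ℕ) :
    {T : EdgeLabeledTableau σ lam mu |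
      (∀ b, T.entry b ∈ S) ∧ ∀ p ∈ T.labels, p.2 ∈ S ∧ p.1.2 < M}.Finite := by
  refine (finite_tableaux S ((range (lam.colLen 0 + 1) ×ˢ range M) ×ˢ S)).subset ?_
  rintro T ⟨h1, h2⟩
  refine ⟨h1, fun p hp => ?_⟩
  have h3 := (T.label_mem p hp).2
  have h4 := lam.colLen_anti 0 p.1.2 (Nat.zero_le _)
  simp only [mem_product, mem_range]
  exact ⟨⟨by omega, (h2 p hp).2⟩, (h2 p hp).1⟩

/-- The edge labeled tableaux with letters in `S` and labels in the first `M` columns. -/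
def boundedTableaux (S : Finset σ) (M : ℕ) (lam mu : YoungDiagram) :
    Finset (EdgeLabeledTableau σ lam mu) :=
  (finite_boundedTableaux S M).toFinset

theorem mem_boundedTableaux {S : Finset σ} {M : ℕ} {T : EdgeLabeledTableau σ lam mu} :
    T ∈ boundedTableaux S M lam mu ↔
      (∀ b, T.entry b ∈ S) ∧ ∀ p ∈ T.labels, p.2 ∈ S ∧ p.1.2 < M := by
  simp [boundedTableaux]

/-- The polynomial ring in which the weights of tableaux live. -/
abbrev XPoly (σ : Type) : Type := MvPolynomial σ (MvPolynomial ℤ ℤ)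

/-- The variable `a_c`. -/
def aVar (σ : Type) (c : ℤ) : XPoly σ := MvPolynomial.C (MvPolynomial.X c)

/-- The weight of an edge labeled tableau. -/
def EdgeLabeledTableau.wt (T : EdgeLabeledTableau σ lam mu) : XPoly σ :=
  (∏ b, MvPolynomial.X (T.entry b)) *
    ∏ p ∈ T.labels, MvPolynomial.X p.2 * aVar σ ((p.1.2 : ℤ) - (p.1.1 : ℤ))

theorem EdgeLabeledTableau.wt_eq_monomial (T : EdgeLabeledTableau σ lam mu) :
    T.wt = MvPolynomial.monomial T.xExp (MvPolynomial.monomial T.aExp 1) := by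
  have h1 : ∀ {ι : Type} (s : Finset ι) (f : ι → σ),
      ∏ i ∈ s, (MvPolynomial.X (f i) : XPoly σ) =
        MvPolynomial.monomial (∑ i ∈ s, Finsupp.single (f i) 1) 1 := by
    intro ι s f
    rw [MvPolynomial.monomial_sum_one]
    rfl
  have h2 : ∏ p ∈ T.labels, aVar σ ((p.1.2 : ℤ) - (p.1.1 : ℤ)) =
      MvPolynomial.C (MvPolynomial.monomial T.aExp 1) := by
    rw [EdgeLabeledTableau.aExp, MvPolynomial.monomial_sum_one, map_prod]
    rfl
  rw [EdgeLabeledTableau.wt, prod_mul_distrib, h2, h1, h1, ← mul_assoc, MvPolynomial.monomial_mul,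
    mul_comm, MvPolynomial.C_mul_monomial]
  simp [EdgeLabeledTableau.xExp, SkewTableau.xExp]

/-- The generating function of the edge labeled tableaux with letters in `S` and labels in the first
`M` columns. -/
def tableauxSum (S : Finset σ) (M : ℕ) (lam mu : YoungDiagram) : XPoly σ :=
  ∑ T ∈ boundedTableaux S M lam mu, T.wt

theorem tableauxSum_empty (M : ℕ) (h : mu ≤ lam) :
    tableauxSum (∅ : Finset σ) M lam mu = open Classical in if mu = lam then 1 else 0 := by
  classical
  split_ifs with heq
  · subst heq
    have hemp : ∀ b : ↥(mu.cells \ mu.cells), False := fun b => by simpa using b.2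
    let T : EdgeLabeledTableau σ mu mu :=
      { entry := fun b => (hemp b).elim
        row_weak := fun b => (hemp b).elim
        col_strict := fun b => (hemp b).elim
        labels := ∅
        label_mem := by simp
        above_lt := by simp
        lt_below := by simp }
    have : boundedTableaux (∅ : Finset σ) M mu mu = {T} := by
      ext T'
      rw [mem_boundedTableaux, mem_singleton]
      constructor
      · rintro ⟨-, h2⟩
        refine EdgeLabeledTableau.ext_entry_labels (fun b => (hemp b).elim) ?_
        refine eq_empty_of_forall_notMem fun p hp => ?_
        simpa using (h2 p hp).1
      · rintro rfl
        exact ⟨fun b => (hemp b).elim, fun p hp => absurd hp (notMem_empty p)⟩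
    rw [tableauxSum, this, sum_singleton, EdgeLabeledTableau.wt,
      prod_eq_one fun b _ => (hemp b).elim]
    simp [T]
  · refine sum_eq_zero fun T hT => ?_
    exfalso
    refine heq (le_antisymm h fun b hb => ?_)
    by_contra hmu
    simpa using (mem_boundedTableaux.1 hT).1 ⟨b, by simpa using ⟨hb, hmu⟩⟩

/-- The diagram formed by `mu` and the boxes with entries at most `l`. -/
def EdgeLabeledTableau.lowerShape (T : EdgeLabeledTableau σ lam mu) (l : σ) : YoungDiagram where
  cells := open Classical in
    lam.cells.filter fun b => ∀ h : b ∈ lam.cells \ mu.cells, T.entry ⟨b, h⟩ ≤ l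
  isLowerSet := by
    classical
    rintro ⟨i, j⟩ ⟨i', j'⟩ hle hmem
    obtain ⟨hi, hj⟩ : i' ≤ i ∧ j' ≤ j := hle
    simp only [coe_filter, Set.mem_ofPred_eq, YoungDiagram.mem_cells] at hmem ⊢
    obtain ⟨h1, h2⟩ := hmem
    refine ⟨lam.up_left_mem hi hj h1, fun h => ?_⟩
    have h3 : (i', j') ∉ mu := by simpa using (mem_sdiff.1 h).2
    have m1 : (i', j) ∈ lam.cells \ mu.cells := by
      rw [mem_sdiff]
      exact ⟨lam.up_left_mem hi le_rfl h1, fun h' => h3 (mu.up_left_mem le_rfl hj h')⟩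
    have m2 : (i, j) ∈ lam.cells \ mu.cells := by
      rw [mem_sdiff]
      exact ⟨h1, fun h' => h3 (mu.up_left_mem hi hj h')⟩
    refine (T.row_weak ⟨_, h⟩ ⟨_, m1⟩ rfl hj).trans (le_trans ?_ (h2 m2))
    rcases hi.eq_or_lt with rfl | hlt
    · rfl
    · exact (T.col_strict ⟨_, m1⟩ ⟨_, m2⟩ rfl hlt).le

theorem EdgeLabeledTableau.mem_lowerShape {T : EdgeLabeledTableau σ lam mu} {l : σ} {b : ℕ × ℕ} :
    b ∈ T.lowerShape l ↔
      b ∈ lam ∧ ∀ h : b ∈ lam.cells \ mu.cells, T.entry ⟨b, h⟩ ≤ l := by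
  classical
  rw [← YoungDiagram.mem_cells]
  simp [EdgeLabeledTableau.lowerShape]

theorem EdgeLabeledTableau.lowerShape_le {T : EdgeLabeledTableau σ lam mu} {l : σ} :
    T.lowerShape l ≤ lam := fun _ hb => (mem_lowerShape.1 hb).1

/-- When `l` is a lower bound for the entries, every added box contains exactly `l`, and a strictly
increasing column contains `l` at most once. -/
theorem EdgeLabeledTableau.isStrip_lowerShape {T : EdgeLabeledTableau σ lam mu} {l : σ}
    (hmu : mu ≤ lam) (hl : ∀ b, l ≤ T.entry b) : IsStrip mu (T.lowerShape l) := by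
  intro j
  refine ⟨colLen_mono (fun b hb => mem_lowerShape.2 ⟨hmu hb, fun h => ?_⟩) j, ?_⟩
  · exact absurd hb (by simpa using (mem_sdiff.1 h).2)
  · by_contra! hlt
    have h1 : (mu.colLen j + 1, j) ∈ T.lowerShape l := YoungDiagram.mem_iff_lt_colLen.2 hlt
    have h2 : (mu.colLen j, j) ∈ T.lowerShape l :=
      YoungDiagram.mem_iff_lt_colLen.2 (by omega)
    have m1 : (mu.colLen j + 1, j) ∈ lam.cells \ mu.cells := by
      rw [mem_sdiff, YoungDiagram.mem_cells, YoungDiagram.mem_cells]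
      exact ⟨(mem_lowerShape.1 h1).1, by rw [YoungDiagram.mem_iff_lt_colLen]; omega⟩
    have m2 : (mu.colLen j, j) ∈ lam.cells \ mu.cells := by
      rw [mem_sdiff, YoungDiagram.mem_cells, YoungDiagram.mem_cells]
      exact ⟨(mem_lowerShape.1 h2).1, by rw [YoungDiagram.mem_iff_lt_colLen]; omega⟩
    have h3 := T.col_strict ⟨_, m2⟩ ⟨_, m1⟩ rfl (by simp)
    exact absurd (h3.trans_le ((mem_lowerShape.1 h1).2 m1)) (not_lt.2 (hl _))

end Tableaux

/-- The columns among the first `M` which have the same length in `mu` and `nu`. -/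
def freeCols (M : ℕ) (mu nu : YoungDiagram) : Finset ℕ :=
  {j ∈ range M | nu.colLen j = mu.colLen j}

theorem mem_freeCols {M : ℕ} {mu nu : YoungDiagram} {j : ℕ} :
    j ∈ freeCols M mu nu ↔ j < M ∧ nu.colLen j = mu.colLen j := by
  simp [freeCols]

/-- Expanding the factors `1 + x * a_c` makes the choice of labels explicit: `A` is the set of
columns in which the letter occurs as a label. -/
theorem stripWeight_eq_sum {R : Type*} [CommRing R] (a : ℤ → R) {M : ℕ} (x : R)
    {mu nu : YoungDiagram} (hM : nu.rowLen 0 ≤ M) (h : IsStrip mu nu) :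
    stripWeight a M x mu nu = (∏ _b ∈ nu.cells \ mu.cells, x) *
      ∑ A ∈ (freeCols M mu nu).powerset, ∏ j ∈ A, x * a ((j : ℤ) - mu.colLen j) := by
  rw [← prod_one_add, stripWeight,
    ← prod_filter_mul_prod_filter_not (range M) (fun j => nu.colLen j = mu.colLen j), mul_comm]
  congr 1
  · refine prod_bij (fun j _ => (mu.colLen j, j)) ?_ ?_ ?_ ?_
    · intro j hj
      have h1 := (mem_filter.1 hj).2
      have h2 := h j
      rw [mem_sdiff, YoungDiagram.mem_cells, YoungDiagram.mem_cells,
        YoungDiagram.mem_iff_lt_colLen, YoungDiagram.mem_iff_lt_colLen]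
      omega
    · intro j _ j' _ hjj
      exact (Prod.mk.inj hjj).2
    · rintro ⟨i, j⟩ hb
      rw [mem_sdiff, YoungDiagram.mem_cells, YoungDiagram.mem_cells,
        YoungDiagram.mem_iff_lt_colLen, YoungDiagram.mem_iff_lt_colLen] at hb
      have h2 := h j
      have h3 := (lt_rowLen_iff nu 0 j).2 (by omega)
      refine ⟨j, mem_filter.2 ⟨mem_range.2 (by omega), by omega⟩, ?_⟩
      rw [Prod.mk.injEq]
      exact ⟨by omega, rfl⟩
    · intro j hj
      have h1 := (mem_filter.1 hj).2
      have h2 := h j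
      rw [colWeight, if_neg h1, if_pos (by omega)]
  · refine prod_congr rfl fun j hj => ?_
    rw [colWeight, if_pos (mem_freeCols.1 hj).2]

/-! ### Removing and restoring the smallest letter. -/

section Glue

variable {σ : Type} [LinearOrder σ] {lam mu nu : YoungDiagram}

theorem mem_skew {b : ℕ × ℕ} : b ∈ lam.cells \ mu.cells ↔ b ∈ lam ∧ b ∉ mu := by
  simp

/-- Add to a tableau of shape `lam / nu` the letter `l` in all boxes of `nu / mu` and as a label in
the columns in `A`. -/
def glue (hmn : mu ≤ nu) (hnl : nu ≤ lam) (l : σ) (A : Finset ℕ)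
    (hA : ∀ j ∈ A, nu.colLen j = mu.colLen j) (hstrip : IsStrip mu nu)
    (T : EdgeLabeledTableau σ lam nu) (hT : ∀ b, l < T.entry b) (hT' : ∀ p ∈ T.labels, l < p.2) :
    EdgeLabeledTableau σ lam mu where
  entry b := if h : b.1 ∈ lam.cells \ nu.cells then T.entry ⟨b.1, h⟩ else l
  row_weak := by
    rintro ⟨⟨i, j⟩, hb⟩ ⟨⟨i', j'⟩, hb'⟩ h1 h2
    simp only at h1 h2 ⊢
    subst h1
    split_ifs with h3 h4 h4
    · exact T.row_weak _ _ rfl h2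
    · exfalso
      rw [mem_skew] at *
      exact h4 ⟨hb'.1, fun h => h3.2 (nu.up_left_mem le_rfl h2 h)⟩
    · exact (hT _).le
    · exact le_rfl
  col_strict := by
    rintro ⟨⟨i, j⟩, hb⟩ ⟨⟨i', j'⟩, hb'⟩ h1 h2
    simp only at h1 h2 ⊢
    subst h1
    split_ifs with h3 h4 h4
    · exact T.col_strict _ _ rfl h2
    · exfalso
      rw [mem_skew] at *
      exact h4 ⟨hb'.1, fun h => h3.2 (nu.up_left_mem h2.le le_rfl h)⟩
    · exact hT _
    · exfalso
      rw [mem_skew] at *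
      have h5 := hstrip j
      have h6 : (i', j) ∈ nu := by by_contra h; exact h4 ⟨hb'.1, h⟩
      have h7 := hb.2
      rw [YoungDiagram.mem_iff_lt_colLen] at h6 h7
      omega
  labels := T.labels ∪ A.image fun j => ((mu.colLen j, j), l)
  label_mem := by
    intro p hp
    rw [mem_union, mem_image] at hp
    rcases hp with hp | ⟨j, hj, rfl⟩
    · have h1 := T.label_mem p hp
      exact ⟨(colLen_mono hmn _).trans h1.1, h1.2⟩
    · exact ⟨le_rfl, colLen_mono (hmn.trans hnl) _⟩
  above_lt := by
    rintro ⟨⟨i, j⟩, hb⟩ k hk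
    rw [mem_union, mem_image] at hk
    simp only
    rcases hk with hk | ⟨j', hj', he⟩
    · split_ifs with h
      · exact T.above_lt ⟨_, h⟩ k hk
      · exact hT' _ hk
    · exfalso
      simp only [Prod.mk.injEq] at he
      obtain ⟨⟨h1, rfl⟩, -⟩ := he
      exact (mem_skew.1 hb).2 (YoungDiagram.mem_iff_lt_colLen.2 (by omega))
  lt_below := by
    rintro ⟨⟨i, j⟩, hb⟩ k hk
    rw [mem_union, mem_image] at hk
    simp only
    rcases hk with hk | ⟨j', hj', he⟩
    · split_ifs with h
      · exact T.lt_below ⟨_, h⟩ k hk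
      · exfalso
        -- Labels of `T` lie on or below the lower boundary of `nu`, so the box under such an edge
        -- cannot belong to `nu`.
        have h1 := (T.label_mem _ hk).1
        simp only at h1
        refine h (mem_skew.2 ⟨(mem_skew.1 hb).1, ?_⟩)
        rw [YoungDiagram.mem_iff_lt_colLen]
        omega
    · simp only [Prod.mk.injEq] at he
      obtain ⟨⟨h1, rfl⟩, rfl⟩ := he
      have h3 := hA _ hj'
      split_ifs with h
      · exact hT _
      · exfalso
        refine h (mem_skew.2 ⟨(mem_skew.1 hb).1, ?_⟩)
        rw [YoungDiagram.mem_iff_lt_colLen]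
        omega

theorem wt_glue (hmn : mu ≤ nu) (hnl : nu ≤ lam) (l : σ) (A : Finset ℕ)
    (hA : ∀ j ∈ A, nu.colLen j = mu.colLen j) (hstrip : IsStrip mu nu)
    (T : EdgeLabeledTableau σ lam nu) (hT : ∀ b, l < T.entry b) (hT' : ∀ p ∈ T.labels, l < p.2) :
    (glue hmn hnl l A hA hstrip T hT hT').wt =
      ((∏ _b ∈ nu.cells \ mu.cells, MvPolynomial.X l) *
        ∏ j ∈ A, MvPolynomial.X l * aVar σ ((j : ℤ) - mu.colLen j)) * T.wt := by
  have hboxes : ∏ b, (MvPolynomial.X ((glue hmn hnl l A hA hstrip T hT hT').entry b) : XPoly σ) =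
      (∏ _b ∈ nu.cells \ mu.cells, MvPolynomial.X l) * ∏ b, MvPolynomial.X (T.entry b) := by
    let e : ℕ × ℕ → XPoly σ := fun b =>
      MvPolynomial.X (if h : b ∈ lam.cells \ nu.cells then T.entry ⟨b, h⟩ else l)
    have hset : lam.cells \ mu.cells = (nu.cells \ mu.cells) ∪ (lam.cells \ nu.cells) := by
      ext b
      rw [mem_union, mem_skew, mem_skew, mem_skew]
      have h1 := @hmn b
      have h2 := @hnl b
      tauto
    have hdisj : Disjoint (nu.cells \ mu.cells) (lam.cells \ nu.cells) := by
      rw [Finset.disjoint_left]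
      intro b
      rw [mem_skew, mem_skew]
      tauto
    change ∏ b : ↥(lam.cells \ mu.cells), e b.1 = _
    rw [prod_coe_sort (lam.cells \ mu.cells) e, hset, prod_union hdisj]
    congr 1
    · refine prod_congr rfl fun b hb => ?_
      simp only [e]
      rw [dif_neg fun h => (mem_skew.1 h).2 (mem_skew.1 hb).1]
    · rw [← prod_coe_sort (lam.cells \ nu.cells) e]
      refine prod_congr rfl fun b _ => ?_
      simp only [e]
      rw [dif_pos b.2]
  have hlabels : ∏ p ∈ (glue hmn hnl l A hA hstrip T hT hT').labels,
      (MvPolynomial.X p.2 * aVar σ ((p.1.2 : ℤ) - (p.1.1 : ℤ))) =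
      (∏ p ∈ T.labels, (MvPolynomial.X p.2 * aVar σ ((p.1.2 : ℤ) - (p.1.1 : ℤ)))) *
        ∏ j ∈ A, MvPolynomial.X l * aVar σ ((j : ℤ) - mu.colLen j) := by
    change ∏ p ∈ T.labels ∪ A.image (fun j => ((mu.colLen j, j), l)), _ = _
    rw [prod_union, prod_image]
    · intro j _ j' _ h
      simp only [Prod.mk.injEq] at h
      exact h.1.2
    · rw [Finset.disjoint_left]
      intro p hp hp'
      obtain ⟨j, -, rfl⟩ := mem_image.1 hp'
      exact lt_irrefl _ (hT' _ hp)
  rw [EdgeLabeledTableau.wt, hboxes, hlabels, EdgeLabeledTableau.wt]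
  ring

/-- Remove the letter `l` from a tableau in which it is the smallest letter. -/
def peel (T : EdgeLabeledTableau σ lam mu) (l : σ) (hmu : mu ≤ T.lowerShape l) :
    EdgeLabeledTableau σ lam (T.lowerShape l) where
  entry b := T.entry ⟨b.1, mem_skew.2 ⟨(mem_skew.1 b.2).1, fun h => (mem_skew.1 b.2).2 (hmu h)⟩⟩
  row_weak b b' h1 h2 := T.row_weak _ _ h1 h2
  col_strict b b' h1 h2 := T.col_strict _ _ h1 h2
  labels := T.labels.filter fun p => l < p.2
  label_mem := by
    rintro ⟨⟨i, j⟩, k⟩ hp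
    obtain ⟨hp, hlk⟩ := mem_filter.1 hp
    have h1 := T.label_mem _ hp
    refine ⟨?_, h1.2⟩
    -- If the edge were above the boundary of `T.lowerShape l`, the box below it would have an entry
    -- at most `l`, yet greater than the label `k > l`.
    by_contra! hlt
    simp only at h1 hlt
    have h2 := EdgeLabeledTableau.mem_lowerShape.1 (YoungDiagram.mem_iff_lt_colLen.2 hlt)
    have h3 : (i, j) ∈ lam.cells \ mu.cells :=
      mem_skew.2 ⟨h2.1, by rw [YoungDiagram.mem_iff_lt_colLen]; omega⟩
    exact absurd ((T.lt_below ⟨_, h3⟩ k hp).trans_le (h2.2 h3)) (not_lt.2 hlk.le)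
  above_lt b k hk := T.above_lt _ k (mem_filter.1 hk).1
  lt_below b k hk := T.lt_below _ k (mem_filter.1 hk).1

theorem lowerShape_glue (hmn : mu ≤ nu) (hnl : nu ≤ lam) (l : σ) (A : Finset ℕ)
    (hA : ∀ j ∈ A, nu.colLen j = mu.colLen j) (hstrip : IsStrip mu nu)
    (T : EdgeLabeledTableau σ lam nu) (hT : ∀ b, l < T.entry b) (hT' : ∀ p ∈ T.labels, l < p.2) :
    (glue hmn hnl l A hA hstrip T hT hT').lowerShape l = nu := by
  refine SetLike.ext fun b => ?_
  rw [EdgeLabeledTableau.mem_lowerShape]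
  constructor
  · rintro ⟨h1, h2⟩
    by_contra h3
    have h4 := h2 (mem_skew.2 ⟨h1, fun h => h3 (hmn h)⟩)
    have h5 : b ∈ lam.cells \ nu.cells := mem_skew.2 ⟨h1, h3⟩
    simp only [glue, dif_pos h5] at h4
    exact absurd (hT _) (not_lt.2 h4)
  · intro h1
    refine ⟨hnl h1, fun h2 => ?_⟩
    simp only [glue]
    rw [dif_neg fun h => (mem_skew.1 h).2 h1]

/-- A minimal letter cannot lie under a box of `lam / mu`, which leaves only the bottom edge of `mu`
in its column. The box below that edge, if there is one, must exceed `l`, so the strip of letters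
`l` misses the column. -/
theorem label_eq_of_le {T : EdgeLabeledTableau σ lam mu} {l : σ} (hmu : mu ≤ lam)
    (hl : ∀ b, l ≤ T.entry b) {i j : ℕ} (h : ((i, j), l) ∈ T.labels) :
    i = mu.colLen j ∧ (T.lowerShape l).colLen j = mu.colLen j := by
  have h1 := T.label_mem _ h
  simp only at h1
  have hi : i = mu.colLen j := by
    by_contra hne
    obtain ⟨k, rfl⟩ : ∃ k, i = k + 1 := ⟨i - 1, by omega⟩
    have h2 : (k, j) ∈ lam.cells \ mu.cells := by
      rw [mem_skew, YoungDiagram.mem_iff_lt_colLen, YoungDiagram.mem_iff_lt_colLen]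
      omega
    exact absurd (T.above_lt ⟨_, h2⟩ l h) (not_lt.2 (hl _))
  refine ⟨hi, ?_⟩
  subst hi
  have hs := EdgeLabeledTableau.isStrip_lowerShape hmu hl j
  by_contra hne
  have h3 := EdgeLabeledTableau.mem_lowerShape.1
    (YoungDiagram.mem_iff_lt_colLen.2 (show mu.colLen j < (T.lowerShape l).colLen j by omega))
  have h4 : (mu.colLen j, j) ∈ lam.cells \ mu.cells :=
    mem_skew.2 ⟨h3.1, by rw [YoungDiagram.mem_iff_lt_colLen]; omega⟩
  exact absurd ((T.lt_below ⟨_, h4⟩ l h).trans_le (h3.2 h4)) (lt_irrefl _)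

/-- `glue` is a weight-preserving bijection from pairs (columns labeled `l`, tableau in larger
letters) onto the tableaux whose letters `l` fill exactly `nu / mu`. Its inverse is given by `peel`
and the set of columns with label `l`. -/
theorem tableauxSum_fiber {S : Finset σ} {M : ℕ} {l : σ} (hl : ∀ s ∈ S, l < s)
    [DecidablePred fun T : EdgeLabeledTableau σ lam mu => T.lowerShape l = nu]
    (hM : nu.rowLen 0 ≤ M) (hmn : mu ≤ nu) (hnl : nu ≤ lam) (hstrip : IsStrip mu nu) :
    ∑ T ∈ boundedTableaux (insert l S) M lam mu with T.lowerShape l = nu, T.wt =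
      stripWeight (aVar σ) M (MvPolynomial.X l) mu nu * tableauxSum S M lam nu := by
  rw [stripWeight_eq_sum _ _ hM hstrip, tableauxSum, mul_assoc, sum_mul_sum, mul_sum]
  simp only [mul_sum]
  rw [← sum_product']
  have hA : ∀ q ∈ (freeCols M mu nu).powerset ×ˢ boundedTableaux S M lam nu,
      ∀ j ∈ q.1, nu.colLen j = mu.colLen j := fun q hq j hj =>
    (mem_freeCols.1 (mem_powerset.1 (mem_product.1 hq).1 hj)).2
  have hT : ∀ q ∈ (freeCols M mu nu).powerset ×ˢ boundedTableaux S M lam nu,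
      ∀ b, l < q.2.entry b := fun q hq b =>
    hl _ ((mem_boundedTableaux.1 (mem_product.1 hq).2).1 b)
  have hT' : ∀ q ∈ (freeCols M mu nu).powerset ×ˢ boundedTableaux S M lam nu,
      ∀ p ∈ q.2.labels, l < p.2 := fun q hq p hp =>
    hl _ ((mem_boundedTableaux.1 (mem_product.1 hq).2).2 p hp).1
  symm
  refine sum_bij (fun q hq => glue hmn hnl l q.1 (hA q hq) hstrip q.2 (hT q hq) (hT' q hq))
    ?_ ?_ ?_ ?_
  · rintro ⟨A, T⟩ hq
    rw [mem_filter, mem_boundedTableaux]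
    obtain ⟨h1, h2⟩ := mem_product.1 hq
    simp only [mem_powerset, mem_boundedTableaux] at h1 h2
    refine ⟨⟨fun b => ?_, fun p hp => ?_⟩, lowerShape_glue ..⟩
    · simp only [glue]
      split_ifs with h
      · exact mem_insert_of_mem (h2.1 _)
      · exact mem_insert_self _ _
    · simp only [glue, mem_union, mem_image] at hp
      rcases hp with hp | ⟨j, hj, rfl⟩
      · exact ⟨mem_insert_of_mem (h2.2 p hp).1, (h2.2 p hp).2⟩
      · exact ⟨mem_insert_self _ _, (mem_freeCols.1 (h1 hj)).1⟩
  · rintro ⟨A, T⟩ hq ⟨A', T'⟩ hq' heq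
    have hent : ∀ b, T.entry b = T'.entry b := by
      intro b
      have hb : b.1 ∈ lam.cells \ mu.cells :=
        mem_skew.2 ⟨(mem_skew.1 b.2).1, fun h => (mem_skew.1 b.2).2 (hmn h)⟩
      have := congrArg (fun U : EdgeLabeledTableau σ lam mu => U.entry ⟨b.1, hb⟩) heq
      simpa [glue, dif_pos b.2, -mem_sdiff] using this
    have hlab := congrArg (fun U : EdgeLabeledTableau σ lam mu => U.labels) heq
    simp only [glue] at hlab
    have h1 := hT' _ hq
    have h2 := hT' _ hq'
    simp only at h1 h2
    -- The two parts of the label set are told apart by whether the letter is `l` or larger. One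
    -- inclusion suffices, being applied in both directions.
    have hAA : ∀ {A B : Finset ℕ} {U V : Finset ((ℕ × ℕ) × σ)}, (∀ p ∈ U, l < p.2) →
        (∀ p ∈ V, l < p.2) →
        U ∪ A.image (fun j => ((mu.colLen j, j), l)) =
          V ∪ B.image (fun j => ((mu.colLen j, j), l)) →
        A ⊆ B ∧ U ⊆ V := by
      intro A B U V hU hV he
      constructor
      · intro j hj
        have : ((mu.colLen j, j), l) ∈ V ∪ B.image (fun j => ((mu.colLen j, j), l)) := by
          rw [← he]
          exact mem_union_right _ (mem_image_of_mem _ hj)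
        rcases mem_union.1 this with h | h
        · exact absurd (hV _ h) (lt_irrefl _)
        · obtain ⟨j', hj', e⟩ := mem_image.1 h
          simp only [Prod.mk.injEq] at e
          rw [← e.1.2]
          exact hj'
      · intro p hp
        have : p ∈ V ∪ B.image (fun j => ((mu.colLen j, j), l)) := by
          rw [← he]
          exact mem_union_left _ hp
        rcases mem_union.1 this with h | h
        · exact h
        · obtain ⟨j', hj', rfl⟩ := mem_image.1 h
          exact absurd (hU _ hp) (lt_irrefl _)
    have e1 := hAA h1 h2 hlab
    have e2 := hAA h2 h1 hlab.symm
    rw [Prod.mk.injEq]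
    exact ⟨e1.1.antisymm e2.1, EdgeLabeledTableau.ext_entry_labels hent (e1.2.antisymm e2.2)⟩
  · intro T hTmem
    obtain ⟨hTb, rfl⟩ := mem_filter.1 hTmem
    obtain ⟨hT1, hT2⟩ := mem_boundedTableaux.1 hTb
    have hmin : ∀ s ∈ insert l S, l ≤ s := by
      intro s hs
      rcases mem_insert.1 hs with rfl | hs
      · exact le_rfl
      · exact (hl s hs).le
    have hlT : ∀ b, l ≤ T.entry b := fun b => hmin _ (hT1 b)
    have hmu : mu ≤ lam := hmn.trans hnl
    let A : Finset ℕ := (range M).filter fun j => ((mu.colLen j, j), l) ∈ T.labels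
    have hmemS : ∀ s ∈ insert l S, l < s → s ∈ S := by
      intro s hs hls
      rcases mem_insert.1 hs with rfl | hs
      · exact absurd hls (lt_irrefl _)
      · exact hs
    have hq : (A, peel T l hmn) ∈
        (freeCols M mu (T.lowerShape l)).powerset ×ˢ
          boundedTableaux S M lam (T.lowerShape l) := by
      rw [mem_product, mem_powerset, mem_boundedTableaux]
      refine ⟨fun j hj => ?_, fun b => ?_, fun p hp => ?_⟩
      · obtain ⟨h1, h2⟩ := mem_filter.1 hj
        exact mem_freeCols.2 ⟨mem_range.1 h1, (label_eq_of_le hmu hlT h2).2⟩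
      · refine hmemS _ (hT1 _) ?_
        obtain ⟨b, hb⟩ := b
        by_contra hle
        refine (mem_skew.1 hb).2 (EdgeLabeledTableau.mem_lowerShape.2 ⟨(mem_skew.1 hb).1, ?_⟩)
        intro h
        exact not_lt.1 hle
      · obtain ⟨h1, h2⟩ := mem_filter.1 hp
        exact ⟨hmemS _ (hT2 p h1).1 h2, (hT2 p h1).2⟩
    refine ⟨(A, peel T l hmn), hq, EdgeLabeledTableau.ext_entry_labels ?_ ?_⟩
    · rintro ⟨b, hb⟩
      simp only [glue, peel]
      split_ifs with h
      · rfl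
      · refine le_antisymm (hlT _) ?_
        have : b ∈ T.lowerShape l := by
          by_contra h'
          exact h (mem_skew.2 ⟨(mem_skew.1 hb).1, h'⟩)
        exact (EdgeLabeledTableau.mem_lowerShape.1 this).2 hb
    · ext ⟨⟨i, j⟩, k⟩
      simp only [glue, peel, mem_union, mem_filter, mem_image, A, mem_range]
      constructor
      · rintro (h | ⟨j', h, he⟩)
        · exact h.1
        · rw [← he]
          exact h.2
      · intro h
        rcases (hmin _ (hT2 _ h).1).eq_or_lt with he | hlt
        · right
          simp only at he
          subst he
          obtain ⟨rfl, -⟩ := label_eq_of_le hmu hlT h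
          exact ⟨j, ⟨(hT2 _ h).2, h⟩, rfl⟩
        · exact Or.inl ⟨h, hlt⟩
  · rintro ⟨A, T⟩ hq
    rw [wt_glue]
    ring

theorem tableauxSum_insert {S : Finset σ} {M : ℕ} {l : σ} (hl : ∀ s ∈ S, l < s)
    (hM : lam.rowLen 0 ≤ M) (hmu : mu ≤ lam) :
    tableauxSum (insert l S) M lam mu =
      ∑ nu ∈ subdiagrams lam,
        stripWeight (aVar σ) M (MvPolynomial.X l) mu nu * tableauxSum S M lam nu := by
  classical
  rw [tableauxSum, ← sum_fiberwise_of_maps_to (t := subdiagrams lam) (g := fun T => T.lowerShape l)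
    fun T _ => mem_subdiagrams.2 T.lowerShape_le]
  refine sum_congr rfl fun nu hnu => ?_
  rw [mem_subdiagrams] at hnu
  by_cases hstrip : IsStrip mu nu
  · exact tableauxSum_fiber hl ((rowLen_mono hnu 0).trans hM)
      (le_of_colLen_le fun j => (hstrip j).1) hnu hstrip
  · rw [stripWeight_eq_zero hM hmu hnu hstrip, zero_mul]
    refine sum_eq_zero fun T hT => ?_
    exfalso
    obtain ⟨hTb, rfl⟩ := mem_filter.1 hT
    refine hstrip (EdgeLabeledTableau.isStrip_lowerShape hmu fun b => ?_)
    rcases mem_insert.1 ((mem_boundedTableaux.1 hTb).1 b) with h | h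
    · exact h.ge
    · exact (hl _ h).le

theorem tableauxSum_eq_chainSum {M : ℕ} (hM : lam.rowLen 0 ≤ M) (L : List σ)
    (hL : L.Pairwise (· < ·)) : ∀ mu ≤ lam,
    tableauxSum L.toFinset M lam mu =
      chainSum (aVar σ) M lam (L.map MvPolynomial.X) mu := by
  induction L with
  | nil =>
    intro mu hmu
    exact tableauxSum_empty M hmu
  | cons l L ih =>
    intro mu hmu
    rw [List.pairwise_cons] at hL
    rw [List.toFinset_cons, tableauxSum_insert (by simpa using hL.1) hM hmu]
    refine sum_congr rfl fun nu hnu => ?_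
    rw [ih hL.2 nu (mem_subdiagrams.1 hnu)]

/-- Although `e` need not preserve the order of letters, the sorted list of `S.image e` is a
permutation of the image of the sorted list of `S`, and `chainSum` ignores the order. -/
theorem rename_tableauxSum {M : ℕ} (hM : lam.rowLen 0 ≤ M) (hmu : mu ≤ lam) (e : Equiv.Perm σ)
    (S : Finset σ) :
    MvPolynomial.rename e (tableauxSum S M lam mu) = tableauxSum (S.image e) M lam mu := by
  have hsort : ∀ S : Finset σ, tableauxSum S M lam mu =
      chainSum (aVar σ) M lam ((S.sort (· ≤ ·)).map MvPolynomial.X) mu := by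
    intro S
    rw [← tableauxSum_eq_chainSum hM _ (Finset.sortedLT_sort S).pairwise mu hmu, sort_toFinset]
  rw [hsort, hsort]
  have h1 := map_chainSum (MvPolynomial.rename e : XPoly σ →ₐ[_] XPoly σ).toRingHom (aVar σ) M lam
    ((S.sort (· ≤ ·)).map MvPolynomial.X) mu
  simp only [AlgHom.toRingHom_eq_coe, RingHom.coe_coe, List.map_map] at h1
  rw [h1]
  have h2 : (fun c => MvPolynomial.rename e (aVar σ c)) = aVar σ := by
    funext c
    simp [aVar]
  have h3 : (⇑(MvPolynomial.rename e : XPoly σ →ₐ[_] XPoly σ)) ∘ MvPolynomial.X =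
      MvPolynomial.X ∘ e := by
    funext c
    simp
  rw [h2, h3, ← List.map_map]
  refine chainSum_perm _ hM (List.Perm.map _ ?_) mu hmu
  rw [List.perm_ext_iff_of_nodup ((Finset.sort_nodup _ _).map e.injective) (Finset.sort_nodup _ _)]
  intro s
  simp

end Glue

/-! ### Coefficients, finiteness and degrees. -/

section Weights

variable {σ : Type} [LinearOrder σ] {lam mu : YoungDiagram}

theorem EdgeLabeledTableau.entry_mem_support (T : EdgeLabeledTableau σ lam mu)
    (b : ↥(lam.cells \ mu.cells)) : T.entry b ∈ T.xExp.support := by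
  rw [Finsupp.mem_support_iff, EdgeLabeledTableau.xExp, SkewTableau.xExp, Finsupp.add_apply,
    Finsupp.finsetSum_apply]
  have h := single_le_sum (f := fun b' => (Finsupp.single (T.entry b') 1 : σ →₀ ℕ) (T.entry b))
    (fun _ _ => Nat.zero_le _) (mem_univ b)
  simp only [Finsupp.single_eq_same] at h
  omega

theorem EdgeLabeledTableau.label_mem_support (T : EdgeLabeledTableau σ lam mu)
    {p : (ℕ × ℕ) × σ} (hp : p ∈ T.labels) : p.2 ∈ T.xExp.support := by
  rw [Finsupp.mem_support_iff, EdgeLabeledTableau.xExp, Finsupp.add_apply,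
    Finsupp.finsetSum_apply]
  have h := single_le_sum (f := fun q => (Finsupp.single q.2 1 : σ →₀ ℕ) p.2)
    (fun _ _ => Nat.zero_le _) hp
  simp only [Finsupp.single_eq_same] at h
  have := Finsupp.finsetSum_apply T.labels (fun q => (Finsupp.single q.2 1 : σ →₀ ℕ)) p.2
  omega

theorem EdgeLabeledTableau.content_mem_support (T : EdgeLabeledTableau σ lam mu)
    {p : (ℕ × ℕ) × σ} (hp : p ∈ T.labels) : (p.1.2 : ℤ) - p.1.1 ∈ T.aExp.support := by
  rw [Finsupp.mem_support_iff, EdgeLabeledTableau.aExp, Finsupp.finsetSum_apply]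
  have h := single_le_sum
    (f := fun q => (Finsupp.single ((q.1.2 : ℤ) - q.1.1) 1 : ℤ →₀ ℕ) ((p.1.2 : ℤ) - p.1.1))
    (fun _ _ => Nat.zero_le _) hp
  simp only [Finsupp.single_eq_same] at h
  omega

theorem exists_column_bound (lam mu : YoungDiagram) (β : ℤ →₀ ℕ) :
    ∃ M, lam.rowLen 0 ≤ M ∧ ∀ T : EdgeLabeledTableau σ lam mu, T.aExp = β →
      ∀ p ∈ T.labels, p.1.2 < M := by
  obtain ⟨m, hm⟩ := β.support.bddAbove
  -- A label in column `j` has content at least `j - lam.colLen 0`, and its content is at most the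
  -- bound `m` on the support of `β`.
  refine ⟨max (lam.rowLen 0) (m.toNat + lam.colLen 0 + 1), le_max_left _ _, ?_⟩
  rintro T rfl p hp
  have h1 := hm (T.content_mem_support hp)
  have h2 := (T.label_mem p hp).2
  have h3 := lam.colLen_anti 0 p.1.2 (Nat.zero_le _)
  omega

theorem tableauxOfWeight_subset (S : Finset σ) {α : σ →₀ ℕ} (hS : α.support ⊆ S) {β : ℤ →₀ ℕ}
    {M : ℕ} (hM : ∀ T : EdgeLabeledTableau σ lam mu, T.aExp = β → ∀ p ∈ T.labels, p.1.2 < M) :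
    tableauxOfWeight lam mu α β ⊆ boundedTableaux S M lam mu := by
  rintro T ⟨rfl, hβ⟩
  rw [mem_coe, mem_boundedTableaux]
  exact ⟨fun b => hS (T.entry_mem_support b),
    fun p hp => ⟨hS (T.label_mem_support hp), hM T hβ p hp⟩⟩

theorem finite_tableauxOfWeight (lam mu : YoungDiagram) (α : σ →₀ ℕ) (β : ℤ →₀ ℕ) :
    (tableauxOfWeight lam mu α β).Finite := by
  obtain ⟨M, -, hM⟩ := exists_column_bound (σ := σ) lam mu β
  exact (finite_toSet _).subset (tableauxOfWeight_subset α.support subset_rfl hM)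

theorem coeff_tableauxSum (S : Finset σ) {α : σ →₀ ℕ} (hS : α.support ⊆ S) {β : ℤ →₀ ℕ}
    {M : ℕ} (hM : ∀ T : EdgeLabeledTableau σ lam mu, T.aExp = β → ∀ p ∈ T.labels, p.1.2 < M) :
    ((tableauxSum S M lam mu).coeff α).coeff β = ((tableauxOfWeight lam mu α β).ncard : ℤ) := by
  classical
  have hset : tableauxOfWeight lam mu α β =
      ({T ∈ boundedTableaux S M lam mu | T.xExp = α ∧ T.aExp = β} : Finset _) := by
    ext T
    simp only [coe_filter, Set.mem_ofPred_eq]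
    exact ⟨fun h => ⟨tableauxOfWeight_subset S hS hM h, h⟩, fun h => h.2⟩
  rw [hset, Set.ncard_coe_finset, card_filter, tableauxSum, MvPolynomial.coeff_sum,
    MvPolynomial.coeff_sum]
  push_cast
  refine sum_congr rfl fun T _ => ?_
  rw [EdgeLabeledTableau.wt_eq_monomial, MvPolynomial.coeff_monomial]
  by_cases h : T.xExp = α <;> simp [h, MvPolynomial.coeff_monomial]

/-- A common truncation bound `M` serves both weights, since it depends only on `β`. Only the finite
support of `α` enters, so infinite alphabets and arbitrary permutations are covered. -/
theorem ncard_tableauxOfWeight_mapDomain (hmu : mu ≤ lam) (e : Equiv.Perm σ) (α : σ →₀ ℕ)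
    (β : ℤ →₀ ℕ) :
    (tableauxOfWeight lam mu (α.mapDomain e) β).ncard = (tableauxOfWeight lam mu α β).ncard := by
  classical
  obtain ⟨M, hM, hM'⟩ := exists_column_bound (σ := σ) lam mu β
  have h1 := coeff_tableauxSum α.support subset_rfl hM'
  have h2 := coeff_tableauxSum (α := α.mapDomain e) (α.support.image e)
    Finsupp.mapDomain_support hM'
  rw [← rename_tableauxSum hM hmu, MvPolynomial.coeff_rename_mapDomain _ e.injective, h1] at h2
  exact_mod_cast h2.symm

theorem SkewTableau.degree_xExp (T : SkewTableau σ lam mu) :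
    T.xExp.degree = (lam.cells \ mu.cells).card := by
  rw [SkewTableau.xExp, map_sum]
  simp

theorem EdgeLabeledTableau.degree_aExp (T : EdgeLabeledTableau σ lam mu) :
    T.aExp.degree = T.labels.card := by
  rw [EdgeLabeledTableau.aExp, map_sum]
  simp

theorem EdgeLabeledTableau.degree_xExp (T : EdgeLabeledTableau σ lam mu) (hmu : mu ≤ lam) :
    T.xExp.degree + mu.card = lam.card + T.aExp.degree := by
  rw [EdgeLabeledTableau.xExp, map_add, SkewTableau.degree_xExp, map_sum, T.degree_aExp,
    card_sdiff_of_subset hmu]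
  simp only [Finsupp.degree_single, sum_const, smul_eq_mul, mul_one]
  have : mu.cells.card ≤ lam.cells.card := card_le_card hmu
  change _ + mu.cells.card = lam.cells.card + _
  omega

/-- A semistandard tableau is an edge labeled tableau without labels. -/
def SkewTableau.toEdgeLabeled (T : SkewTableau σ lam mu) : EdgeLabeledTableau σ lam mu where
  toSkewTableau := T
  labels := ∅
  label_mem := by simp
  above_lt := by simp
  lt_below := by simp

theorem EdgeLabeledTableau.labels_eq_empty {T : EdgeLabeledTableau σ lam mu} (h : T.aExp = 0) :
    T.labels = ∅ := by
  rw [← card_eq_zero, ← T.degree_aExp, h, map_zero]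

theorem ncard_tableauxOfWeight_zero (α : σ →₀ ℕ) :
    (tableauxOfWeight lam mu α 0).ncard =
      ({T | T.xExp = α} : Set (SkewTableau σ lam mu)).ncard := by
  symm
  refine Set.ncard_congr (fun T _ => T.toEdgeLabeled) ?_ ?_ ?_
  · intro T hT
    refine ⟨?_, ?_⟩
    · simpa [SkewTableau.toEdgeLabeled, EdgeLabeledTableau.xExp] using hT
    · simp [SkewTableau.toEdgeLabeled, EdgeLabeledTableau.aExp]
  · intro T T' _ _ h
    exact congrArg EdgeLabeledTableau.toSkewTableau h
  · rintro T ⟨h1, h2⟩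
    have h3 := T.labels_eq_empty h2
    refine ⟨T.toSkewTableau, ?_, ?_⟩
    · simpa [EdgeLabeledTableau.xExp, h3] using h1
    · exact EdgeLabeledTableau.ext_entry_labels (fun _ => rfl) h3.symm

end Weights

/-! ### Symmetry, bounded degree and lowest term of the edge Schur functions. -/

section EdgeSchurFunction

variable {N : ℕ∞} {lam mu : YoungDiagram}

theorem edgeSchur_of_not_le (hmu : ¬ mu ≤ lam) : edgeSchur N lam mu = 0 := if_neg hmu

theorem skewSchur_of_not_le (hmu : ¬ mu ≤ lam) : skewSchur N lam mu = 0 := if_neg hmu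

theorem coeff_skewSchur (hmu : mu ≤ lam) (α : Alphabet N →₀ ℕ) :
    (skewSchur N lam mu).coeff α =
      (({T | T.xExp = α} : Set (SkewTableau (Alphabet N) lam mu)).ncard : ℤ) :=
  congrFun (if_pos hmu : skewSchur N lam mu = _) α

theorem coeff_edgeSchur (hmu : mu ≤ lam) (α : Alphabet N →₀ ℕ) (β : ℤ →₀ ℕ) :
    ((edgeSchur N lam mu).coeff α).coeff β =
      ((tableauxOfWeight (σ := Alphabet N) lam mu α β).ncard : ℤ) :=
  congrFun (congrFun (if_pos hmu : edgeSchur N lam mu = _) α) β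

theorem exists_tableau_of_coeff_ne_zero {α : Alphabet N →₀ ℕ} {β : ℤ →₀ ℕ}
    (h : ((edgeSchur N lam mu).coeff α).coeff β ≠ 0) :
    mu ≤ lam ∧ ∃ T : EdgeLabeledTableau (Alphabet N) lam mu, T.xExp = α ∧ T.aExp = β := by
  by_cases hmu : mu ≤ lam
  · rw [coeff_edgeSchur hmu] at h
    exact ⟨hmu, Set.nonempty_of_ncard_ne_zero (by exact_mod_cast h)⟩
  · rw [edgeSchur_of_not_le hmu] at h
    simp at h

theorem degree_of_coeff_ne_zero {α : Alphabet N →₀ ℕ} {β : ℤ →₀ ℕ}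
    (h : ((edgeSchur N lam mu).coeff α).coeff β ≠ 0) :
    α.degree + mu.card = lam.card + β.degree := by
  obtain ⟨hmu, T, rfl, rfl⟩ := exists_tableau_of_coeff_ne_zero h
  exact T.degree_xExp hmu

theorem coeff_rename_mapDomain (e : Equiv.Perm (Alphabet N)) (f : XSeries N)
    (α : Alphabet N →₀ ℕ) :
    (MvPowerSeries.rename e f).coeff (α.mapDomain e) = f.coeff α := by
  have h := MvPowerSeries.coeff_embDomain_rename e.toEmbedding f α
  rwa [Finsupp.embDomain_eq_mapDomain] at h

theorem isSymmetricX_iff {f : XSeries N} :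
    IsSymmetricX f ↔
      ∀ (e : Equiv.Perm (Alphabet N)) (α : Alphabet N →₀ ℕ),
        f.coeff (α.mapDomain e) = f.coeff α := by
  refine forall_congr' fun e => ⟨fun h α => ?_, fun h => ?_⟩
  · rw [← coeff_rename_mapDomain e f α, h]
  · ext1 α
    have hα : α = (α.mapDomain e.symm).mapDomain e := by
      rw [← Finsupp.mapDomain_comp]
      simp
    rw [hα, coeff_rename_mapDomain, h]

theorem isSymmetricX_edgeSchur (N : ℕ∞) (lam mu : YoungDiagram) :
    IsSymmetricX (edgeSchur N lam mu) := by
  rw [isSymmetricX_iff]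
  intro e α
  by_cases hmu : mu ≤ lam
  · ext β
    rw [coeff_edgeSchur hmu, coeff_edgeSchur hmu, ncard_tableauxOfWeight_mapDomain hmu]
  · rw [edgeSchur_of_not_le hmu]
    simp

theorem hasBoundedDegreeX_edgeSchur (N : ℕ∞) (lam mu : YoungDiagram) :
    HasBoundedDegreeX (edgeSchur N lam mu) := by
  intro β
  refine ⟨lam.card + β.degree, fun α h => ?_⟩
  have := degree_of_coeff_ne_zero h
  omega

theorem coeff_edgeSchur_zero (α : Alphabet N →₀ ℕ) :
    ((edgeSchur N lam mu).coeff α).coeff 0 = (skewSchur N lam mu).coeff α := by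
  by_cases hmu : mu ≤ lam
  · rw [coeff_edgeSchur hmu, coeff_skewSchur hmu, ncard_tableauxOfWeight_zero]
  · rw [edgeSchur_of_not_le hmu, skewSchur_of_not_le hmu]
    simp

theorem edgeSchur_eq_skewSchur_add (N : ℕ∞) (lam mu : YoungDiagram) :
    ∃ H : XSeries N,
      edgeSchur N lam mu = MvPowerSeries.map MvPowerSeries.C (skewSchur N lam mu) + H ∧
      ∀ (α : Alphabet N →₀ ℕ) (β : ℤ →₀ ℕ), (H.coeff α).coeff β ≠ 0 →
        0 < β.degree ∧ α.degree + mu.card = lam.card + β.degree := by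
  classical
  refine ⟨edgeSchur N lam mu - MvPowerSeries.map MvPowerSeries.C (skewSchur N lam mu),
    by ring, fun α β h => ?_⟩
  rw [map_sub, map_sub, MvPowerSeries.coeff_map, MvPowerSeries.coeff_C] at h
  split_ifs at h with hβ
  · subst hβ
    rw [coeff_edgeSchur_zero, sub_self] at h
    exact absurd rfl h
  · rw [sub_zero] at h
    refine ⟨Nat.pos_of_ne_zero fun h0 => hβ ?_, degree_of_coeff_ne_zero h⟩
    exact (Finsupp.degree_eq_zero_iff β).1 h0

end EdgeSchurFunction

/-! ### Unitriangularity at the dominant monomials. -/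

theorem finite_card_le (n : ℕ) : {lam : YoungDiagram | lam.card ≤ n}.Finite := by
  refine (finite_cells_subset (range n ×ˢ range n)).subset ?_
  rintro lam (hlam : lam.cells.card ≤ n) ⟨i, j⟩ hij
  have h1 : lam.colLen j ≤ lam.cells.card := by
    rw [YoungDiagram.colLen_eq_card]
    exact card_le_card (filter_subset _ _)
  have h2 : lam.rowLen i ≤ lam.cells.card := by
    rw [YoungDiagram.rowLen_eq_card]
    exact card_le_card (filter_subset _ _)
  have h3 := YoungDiagram.mem_iff_lt_colLen.1 ((YoungDiagram.mem_cells _).1 hij)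
  have h4 := YoungDiagram.mem_iff_lt_rowLen.1 ((YoungDiagram.mem_cells _).1 hij)
  simp only [mem_product, mem_range]
  omega

/-- The sum of the (one-based) row indices of the boxes. -/
def rowSum (lam : YoungDiagram) : ℕ := ∑ c ∈ lam.cells, (c.1 + 1)

theorem card_le_rowSum (lam : YoungDiagram) : lam.card ≤ rowSum lam := by
  change lam.cells.card ≤ _
  rw [rowSum, card_eq_sum_ones]
  exact sum_le_sum fun c _ => by omega

variable {N : ℕ∞}

theorem finite_partition_card_le (N : ℕ∞) (n : ℕ) :
    {lam : PartitionOfLength N | lam.1.card ≤ n}.Finite :=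
  (finite_card_le n).preimage Subtype.val_injective.injOn

theorem finite_rowSum_le (N : ℕ∞) (n : ℕ) :
    {lam : PartitionOfLength N | rowSum lam.1 ≤ n}.Finite :=
  (finite_partition_card_le N n).subset fun lam h => (card_le_rowSum lam.1).trans h

/-- The weighted degree in which the `i`-th letter has degree `i`. -/
def letterSum (N : ℕ∞) : (Alphabet N →₀ ℕ) →+ ℕ := Finsupp.weight fun i => i.1 + 1

theorem letterSum_single (i : Alphabet N) (n : ℕ) :
    letterSum N (Finsupp.single i n) = n * (i.1 + 1) := by
  simp [letterSum, Finsupp.weight_single]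

theorem letterSum_xExp {lam mu : YoungDiagram} (T : EdgeLabeledTableau (Alphabet N) lam mu) :
    letterSum N T.xExp = ∑ b, ((T.entry b).1 + 1) + ∑ p ∈ T.labels, (p.2.1 + 1) := by
  rw [EdgeLabeledTableau.xExp, SkewTableau.xExp, map_add, map_sum, map_sum]
  simp [letterSum_single]

theorem rowSum_eq (lam : YoungDiagram) :
    rowSum lam = ∑ b : ↥(lam.cells \ (⊥ : YoungDiagram).cells), (b.1.1 + 1) := by
  rw [sum_coe_sort (lam.cells \ (⊥ : YoungDiagram).cells) fun c => c.1 + 1, YoungDiagram.cells_bot,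
    sdiff_empty, rowSum]

theorem row_le_entry {lam : YoungDiagram} (T : SkewTableau (Alphabet N) lam ⊥) :
    ∀ (i j : ℕ) (h : (i, j) ∈ lam.cells \ (⊥ : YoungDiagram).cells), i ≤ (T.entry ⟨(i, j), h⟩).1
  | 0, _, _ => Nat.zero_le _
  | i + 1, j, h => by
    have h' : (i, j) ∈ lam.cells \ (⊥ : YoungDiagram).cells :=
      mem_skew.2
        ⟨lam.up_left_mem (Nat.le_succ i) le_rfl (mem_skew.1 h).1, YoungDiagram.notMem_bot _⟩
    have h1 := row_le_entry T i j h'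
    have h2 : (T.entry ⟨(i, j), h'⟩).1 < (T.entry ⟨(i + 1, j), h⟩).1 :=
      T.col_strict ⟨_, h'⟩ ⟨_, h⟩ rfl (Nat.lt_succ_self i)
    omega

/-- Each entry is at least the index of its row, and labels only add to the weight. -/
theorem rowSum_le_letterSum {lam : YoungDiagram} (T : EdgeLabeledTableau (Alphabet N) lam ⊥) :
    rowSum lam ≤ letterSum N T.xExp := by
  rw [letterSum_xExp, rowSum_eq]
  refine le_add_right (sum_le_sum fun b _ => ?_)
  have := row_le_entry T.toSkewTableau b.1.1 b.1.2 b.2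
  simpa using this

theorem entry_eq_row_of_letterSum_eq {lam : YoungDiagram}
    (T : EdgeLabeledTableau (Alphabet N) lam ⊥) (h : letterSum N T.xExp = rowSum lam) :
    (∀ b, (T.entry b).1 = b.1.1) ∧ T.labels = ∅ := by
  rw [letterSum_xExp, rowSum_eq] at h
  have hle : ∀ b ∈ (univ : Finset ↥(lam.cells \ (⊥ : YoungDiagram).cells)),
      b.1.1 + 1 ≤ (T.entry b).1 + 1 := fun b _ => by
    have := row_le_entry T.toSkewTableau b.1.1 b.1.2 b.2
    simpa using this
  have h1 := sum_le_sum hle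
  have h2 : ∑ b : ↥(lam.cells \ (⊥ : YoungDiagram).cells), (b.1.1 + 1) =
      ∑ b, ((T.entry b).1 + 1) := by omega
  have h3 : ∑ p ∈ T.labels, (p.2.1 + 1) = 0 := by omega
  constructor
  · intro b
    have := (sum_eq_sum_iff_of_le hle).1 h2 b (mem_univ b)
    omega
  · refine eq_empty_of_forall_notMem fun p hp => ?_
    have := (sum_eq_zero_iff.1 h3) p hp
    omega

/-- The tableau of straight shape in which all entries of a row are equal to its index. -/
def superstandard (lam : PartitionOfLength N) : SkewTableau (Alphabet N) lam.1 ⊥ where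
  entry b := ⟨b.1.1, by
    have h1 := YoungDiagram.mem_iff_lt_colLen.1 (mem_skew.1 b.2).1
    have h2 := lam.1.colLen_anti 0 b.1.2 (Nat.zero_le _)
    have h3 : b.1.1 < lam.1.colLen 0 := h1.trans_le h2
    exact lt_of_lt_of_le (by exact_mod_cast h3) lam.2⟩
  row_weak b b' h _ := by
    rw [Subtype.mk_le_mk]
    exact h.le
  col_strict b b' _ h := by
    rw [Subtype.mk_lt_mk]
    exact h

/-- The exponent whose `i`-th entry is the length of the `i`-th row. -/
def rowExp (lam : PartitionOfLength N) : Alphabet N →₀ ℕ := (superstandard lam).xExp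

theorem rowExp_apply (lam : PartitionOfLength N) (i : Alphabet N) :
    rowExp lam i = lam.1.rowLen i.1 := by
  rw [rowExp, SkewTableau.xExp, Finsupp.finsetSum_apply, YoungDiagram.rowLen_eq_card,
    YoungDiagram.row, card_filter]
  have h1 : ∀ b : ↥(lam.1.cells \ (⊥ : YoungDiagram).cells),
      (Finsupp.single ((superstandard lam).entry b) 1 : Alphabet N →₀ ℕ) i =
        if b.1.1 = i.1 then 1 else 0 := by
    intro b
    rw [Finsupp.single_apply]
    simp only [superstandard, Subtype.ext_iff]
  simp only [h1]
  rw [sum_coe_sort (lam.1.cells \ (⊥ : YoungDiagram).cells) fun c => if c.1 = i.1 then 1 else 0,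
    YoungDiagram.cells_bot, sdiff_empty]

theorem rowLen_eq_zero (lam : PartitionOfLength N) {i : ℕ} (hi : ¬ (i : ℕ∞) < N) :
    lam.1.rowLen i = 0 := by
  by_contra hne
  refine hi (lt_of_lt_of_le ?_ lam.2)
  exact_mod_cast (lt_rowLen_iff lam.1 i 0).1 (Nat.pos_of_ne_zero hne)

theorem rowExp_injective : Function.Injective (rowExp (N := N)) := by
  intro lam mu h
  refine Subtype.ext (SetLike.ext ?_)
  rintro ⟨i, j⟩
  rw [YoungDiagram.mem_iff_lt_rowLen, YoungDiagram.mem_iff_lt_rowLen]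
  by_cases hi : (i : ℕ∞) < N
  · have := DFunLike.congr_fun h ⟨i, hi⟩
    rw [rowExp_apply, rowExp_apply] at this
    rw [this]
  · rw [rowLen_eq_zero lam hi, rowLen_eq_zero mu hi]

theorem toEdgeLabeled_superstandard_xExp (lam : PartitionOfLength N) :
    (superstandard lam).toEdgeLabeled.xExp = rowExp lam := by
  simp [EdgeLabeledTableau.xExp, SkewTableau.toEdgeLabeled, rowExp]

theorem letterSum_rowExp (lam : PartitionOfLength N) :
    letterSum N (rowExp lam) = rowSum lam.1 := by
  rw [← toEdgeLabeled_superstandard_xExp, letterSum_xExp, rowSum_eq]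
  simp [SkewTableau.toEdgeLabeled, superstandard]

theorem degree_rowExp (lam : PartitionOfLength N) : (rowExp lam).degree = lam.1.card := by
  rw [rowExp, SkewTableau.degree_xExp, YoungDiagram.cells_bot, sdiff_empty]

theorem eq_superstandard (lam : PartitionOfLength N)
    {T : EdgeLabeledTableau (Alphabet N) lam.1 ⊥} (h : letterSum N T.xExp = rowSum lam.1) :
    T = (superstandard lam).toEdgeLabeled := by
  obtain ⟨h1, h2⟩ := entry_eq_row_of_letterSum_eq T h
  exact EdgeLabeledTableau.ext_entry_labels (fun b => Subtype.ext (h1 b)) h2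

theorem exists_coeff_ne_zero {f : ASeries} (h : f ≠ 0) : ∃ β, f.coeff β ≠ 0 := by
  by_contra! hcon
  exact h (MvPowerSeries.ext fun β => by rw [hcon β, map_zero])

theorem rowSum_le_of_coeff_ne_zero {lam : YoungDiagram} {α : Alphabet N →₀ ℕ}
    (h : (edgeSchur N lam ⊥).coeff α ≠ 0) : rowSum lam ≤ letterSum N α := by
  obtain ⟨β, hβ⟩ := exists_coeff_ne_zero h
  obtain ⟨-, T, rfl, -⟩ := exists_tableau_of_coeff_ne_zero hβ
  exact rowSum_le_letterSum T

theorem finite_coeff_ne_zero (α : Alphabet N →₀ ℕ) :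
    {lam : PartitionOfLength N | (edgeSchur N lam.1 ⊥).coeff α ≠ 0}.Finite :=
  (finite_rowSum_le N (letterSum N α)).subset fun _ h => rowSum_le_of_coeff_ne_zero h

/-- In the equality case `rowSum mu = rowSum lam` the tableau must be superstandard, and its
exponent recovers `mu`. -/
theorem coeff_rowExp_triangular {lam mu : PartitionOfLength N}
    (h : (edgeSchur N mu.1 ⊥).coeff (rowExp lam) ≠ 0) : mu = lam ∨ rowSum mu.1 < rowSum lam.1 := by
  obtain ⟨β, hβ⟩ := exists_coeff_ne_zero h
  obtain ⟨-, T, hT, -⟩ := exists_tableau_of_coeff_ne_zero hβ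
  have h1 := rowSum_le_of_coeff_ne_zero h
  rw [letterSum_rowExp] at h1
  rcases h1.eq_or_lt with heq | hlt
  · left
    have h2 := eq_superstandard mu (T := T) (by rw [hT, letterSum_rowExp, heq])
    apply rowExp_injective
    rw [← hT, h2, toEdgeLabeled_superstandard_xExp]
  · exact Or.inr hlt

theorem coeff_rowExp_self (lam : PartitionOfLength N) :
    (edgeSchur N lam.1 ⊥).coeff (rowExp lam) = 1 := by
  classical
  ext β
  rw [coeff_edgeSchur bot_le, MvPowerSeries.coeff_one]
  have haExp : (superstandard lam).toEdgeLabeled.aExp = 0 := by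
    simp [EdgeLabeledTableau.aExp, SkewTableau.toEdgeLabeled]
  have huniq : ∀ T ∈ tableauxOfWeight lam.1 ⊥ (rowExp lam) β,
      T = (superstandard lam).toEdgeLabeled := fun T hT =>
    eq_superstandard lam (by rw [hT.1, letterSum_rowExp])
  split_ifs with hβ
  · have : tableauxOfWeight lam.1 ⊥ (rowExp lam) β = {(superstandard lam).toEdgeLabeled} := by
      refine Set.Subset.antisymm huniq ?_
      rintro _ rfl
      exact ⟨toEdgeLabeled_superstandard_xExp lam, by rw [haExp, hβ]⟩
    rw [this, Set.ncard_singleton, Nat.cast_one]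
  · have : tableauxOfWeight lam.1 ⊥ (rowExp lam) β = ∅ := by
      refine Set.eq_empty_of_forall_notMem fun T hT => hβ ?_
      rw [← hT.2, huniq T hT, haExp]
    rw [this, Set.ncard_empty, Nat.cast_zero]

theorem exists_rowExp_eq {α : Alphabet N →₀ ℕ} (hα : Antitone α) :
    ∃ lam : PartitionOfLength N, rowExp lam = α := by
  classical
  let r : ℕ → ℕ := fun i => if h : (i : ℕ∞) < N then α ⟨i, h⟩ else 0
  have hr : Antitone r := by
    intro i i' hii
    simp only [r]
    split_ifs with h1 h2 h2
    · exact hα (Subtype.mk_le_mk.2 hii)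
    · exact absurd (lt_of_le_of_lt (by exact_mod_cast hii) h1) h2
    · exact Nat.zero_le _
    · exact le_rfl
  -- Any bound for the support works here: it makes the number of rows finite when the alphabet is
  -- infinite.
  let R : ℕ := α.support.sup fun i => i.1 + 1
  have hR : ∀ i : Alphabet N, α i ≠ 0 → i.1 < R := fun i hi =>
    le_sup (f := fun i : Alphabet N => i.1 + 1) (Finsupp.mem_support_iff.2 hi)
  have hrow : ∀ i, (ofRows R r fun _ _ h _ => hr h).rowLen i = r i := by
    intro i
    refine rowLen_eq_of_mem_iff fun j => ?_
    rw [mem_ofRows]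
    refine ⟨fun h => h.2, fun h => ⟨?_, h⟩⟩
    simp only [r] at h
    split_ifs at h with hi
    · exact hR ⟨i, hi⟩ (by omega)
    · omega
  refine ⟨⟨ofRows R r fun _ _ h _ => hr h, ?_⟩, ?_⟩
  · by_contra! hlt
    obtain ⟨n, rfl⟩ : ∃ n : ℕ, N = n := (ENat.ne_top_iff_exists.1 hlt.ne_top).imp fun _ h => h.symm
    have h1 := (lt_rowLen_iff _ n 0).2 (by exact_mod_cast hlt)
    rw [hrow] at h1
    simp [r] at h1
  · ext i
    rw [rowExp_apply]
    simp only [hrow, r]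
    rw [dif_pos i.2]

theorem letterSum_swap_lt {α : Alphabet N →₀ ℕ} {i j : Alphabet N} (hij : i < j)
    (h : α i < α j) : letterSum N (α.mapDomain (Equiv.swap i j)) < letterSum N α := by
  obtain ⟨d, hd⟩ := Nat.exists_eq_add_of_lt h
  -- The swap moves `d + 1 = α j - α i` units from letter `j` to the earlier letter `i`, written
  -- additively to avoid subtraction.
  have key : α.mapDomain (Equiv.swap i j) + Finsupp.single j (d + 1) =
      α + Finsupp.single i (d + 1) := by
    ext k
    rw [Finsupp.add_apply, Finsupp.add_apply, Finsupp.mapDomain_equiv_apply, Equiv.symm_swap]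
    by_cases hki : k = i
    · subst hki
      rw [Equiv.swap_apply_left, Finsupp.single_eq_same, Finsupp.single_eq_of_ne hij.ne]
      omega
    · by_cases hkj : k = j
      · subst hkj
        rw [Equiv.swap_apply_right, Finsupp.single_eq_same, Finsupp.single_eq_of_ne hij.ne']
        omega
      · rw [Equiv.swap_apply_of_ne_of_ne hki hkj, Finsupp.single_eq_of_ne hki,
          Finsupp.single_eq_of_ne hkj]
  have h1 := congrArg (letterSum N) key
  rw [map_add, map_add, letterSum_single, letterSum_single] at h1
  have h2 : i.1 < j.1 := hij
  have h3 : (d + 1) * (i.1 + 1) < (d + 1) * (j.1 + 1) := by gcongr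
  omega

/-- Sorting by transpositions: each swap of an ascent leaves the coefficients unchanged and lowers
`letterSum`, so every exponent reduces to a weakly decreasing one, which is some `rowExp lam`. -/
theorem IsSymmetricX.ext_rowExp {f g : XSeries N} (hf : IsSymmetricX f) (hg : IsSymmetricX g)
    (h : ∀ lam : PartitionOfLength N, f.coeff (rowExp lam) = g.coeff (rowExp lam)) : f = g := by
  rw [isSymmetricX_iff] at hf hg
  have key : ∀ (n : ℕ) (α : Alphabet N →₀ ℕ), letterSum N α = n → f.coeff α = g.coeff α := by
    intro n
    induction n using Nat.strong_induction_on with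
    | _ n ih =>
      intro α hα
      by_cases hanti : Antitone α
      · obtain ⟨lam, rfl⟩ := exists_rowExp_eq hanti
        exact h lam
      · unfold Antitone at hanti
        push Not at hanti
        obtain ⟨i, j, hij, hlt⟩ := hanti
        have hij' : i < j := lt_of_le_of_ne hij fun he => by subst he; exact lt_irrefl _ hlt
        rw [← hf (Equiv.swap i j), ← hg (Equiv.swap i j)]
        exact ih _ (hα ▸ letterSum_swap_lt hij' hlt) _ rfl
  exact MvPowerSeries.ext fun α => key _ α rfl

/-! ### Existence and uniqueness of expansions. -/

theorem finite_rowSum_lt (N : ℕ∞) (n : ℕ) :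
    {lam : PartitionOfLength N | rowSum lam.1 < n}.Finite := by
  refine (finite_rowSum_le N n).subset ?_
  intro lam (h : rowSum lam.1 < n)
  exact h.le

/-- The partitions with a row sum smaller than that of `lam`. -/
def lowerPartitions (lam : PartitionOfLength N) : Finset (PartitionOfLength N) :=
  (finite_rowSum_lt N (rowSum lam.1)).toFinset

theorem mem_lowerPartitions {lam mu : PartitionOfLength N} :
    mu ∈ lowerPartitions lam ↔ rowSum mu.1 < rowSum lam.1 := by
  simp [lowerPartitions]

theorem finsum_coeff_rowExp (c : PartitionOfLength N → ASeries) (lam : PartitionOfLength N) :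
    ∑ᶠ mu : PartitionOfLength N, c mu * (edgeSchur N mu.1 ⊥).coeff (rowExp lam) =
      c lam + ∑ mu ∈ lowerPartitions lam, c mu * (edgeSchur N mu.1 ⊥).coeff (rowExp lam) := by
  classical
  rw [finsum_eq_sum_of_support_subset (s := insert lam (lowerPartitions lam)), sum_insert,
    coeff_rowExp_self, mul_one]
  · rw [mem_lowerPartitions]
    exact lt_irrefl _
  · intro mu hmu
    rw [coe_insert, Set.mem_insert_iff, mem_coe, mem_lowerPartitions]
    exact coeff_rowExp_triangular (right_ne_zero_of_mul hmu)

/-- The coefficients of the expansion of a symmetric series in edge Schur functions. -/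
def expansionCoeff (f : XSeries N) (lam : PartitionOfLength N) : ASeries :=
  f.coeff (rowExp lam) - ∑ mu : {mu // mu ∈ lowerPartitions lam},
    expansionCoeff f mu.1 * (edgeSchur N mu.1.1 ⊥).coeff (rowExp lam)
termination_by rowSum lam.1
decreasing_by exact mem_lowerPartitions.1 mu.2

theorem finite_mul_coeff_ne_zero (c : PartitionOfLength N → ASeries) (α : Alphabet N →₀ ℕ) :
    {lam : PartitionOfLength N | c lam * (edgeSchur N lam.1 ⊥).coeff α ≠ 0}.Finite :=
  (finite_coeff_ne_zero α).subset fun _ h => right_ne_zero_of_mul h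

theorem isExpansion_expansionCoeff {f : XSeries N} (hf : IsSymmetricX f) :
    IsExpansion (expansionCoeff f) f := by
  let g : XSeries N := fun α =>
    ∑ᶠ lam : PartitionOfLength N, expansionCoeff f lam * (edgeSchur N lam.1 ⊥).coeff α
  have hgc : ∀ α, g.coeff α =
      ∑ᶠ lam : PartitionOfLength N, expansionCoeff f lam * (edgeSchur N lam.1 ⊥).coeff α :=
    fun α => rfl
  have hg : IsSymmetricX g := by
    rw [isSymmetricX_iff]
    intro e α
    rw [hgc, hgc]
    refine finsum_congr fun lam => ?_
    rw [isSymmetricX_iff.1 (isSymmetricX_edgeSchur N lam.1 ⊥)]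
  -- The recursion defining `expansionCoeff` is precisely equality of the coefficients at each
  -- `rowExp lam`; symmetry supplies all other coefficients.
  have hfg : f = g := by
    refine hf.ext_rowExp hg fun lam => ?_
    rw [hgc, finsum_coeff_rowExp, expansionCoeff,
      sum_coe_sort (lowerPartitions lam)
        fun mu => expansionCoeff f mu * (edgeSchur N mu.1 ⊥).coeff (rowExp lam)]
    ring
  intro α
  refine ⟨finite_mul_coeff_ne_zero _ α, ?_⟩
  rw [← hgc, ← hfg]

theorem IsExpansion.unique {f : XSeries N} {c c' : PartitionOfLength N → ASeries}
    (hc : IsExpansion c f) (hc' : IsExpansion c' f) : c = c' := by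
  have key : ∀ (n : ℕ) (lam : PartitionOfLength N), rowSum lam.1 = n → c lam = c' lam := by
    intro n
    induction n using Nat.strong_induction_on with
    | _ n ih =>
      intro lam hlam
      have h := (hc (rowExp lam)).2.symm.trans (hc' (rowExp lam)).2
      rw [finsum_coeff_rowExp, finsum_coeff_rowExp] at h
      rw [sum_congr rfl fun mu hmu => by
        rw [ih _ (hlam ▸ mem_lowerPartitions.1 hmu) mu rfl]] at h
      exact add_right_cancel h
  exact funext fun lam => key _ lam rfl

/-! ### Bounded degree in terms of the expansion coefficients. -/

theorem IsExpansion.hasBoundedDegreeX {f : XSeries N} {c : PartitionOfLength N → ASeries}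
    (hc : IsExpansion c f)
    (hfin : ∀ β : ℤ →₀ ℕ, {lam : PartitionOfLength N | (c lam).coeff β ≠ 0}.Finite) :
    HasBoundedDegreeX f := by
  classical
  intro β
  have hB : (⋃ p ∈ antidiagonal β, {lam : PartitionOfLength N | (c lam).coeff p.1 ≠ 0}).Finite :=
    (finite_toSet (antidiagonal β)).biUnion fun p _ => hfin p.1
  obtain ⟨D, hD⟩ := (hB.image fun lam => lam.1.card).bddAbove
  refine ⟨D + β.degree, fun α hα => ?_⟩
  rw [(hc α).2, finsum_eq_sum_of_support_subset (s := (hc α).1.toFinset) _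
    (fun lam h => by simpa using h), map_sum] at hα
  obtain ⟨lam, -, hlam⟩ := exists_ne_zero_of_sum_ne_zero hα
  rw [MvPowerSeries.coeff_mul] at hlam
  obtain ⟨p, hp, hne⟩ := exists_ne_zero_of_sum_ne_zero hlam
  have h1 := degree_of_coeff_ne_zero (right_ne_zero_of_mul hne)
  have h2 : lam.1.card ≤ D :=
    hD ⟨lam, Set.mem_biUnion (mem_coe.2 hp) (left_ne_zero_of_mul hne), rfl⟩
  have h3 : p.1.degree + p.2.degree = β.degree := by
    rw [← map_add, mem_antidiagonal.1 hp]
  omega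

/-- Induction on the degree of `β`, then on `rowSum`. For large `lam`, the coefficient of `a^β` at
`rowExp lam` vanishes in `f`, and it vanishes in every term of the expansion with `mu ≠ lam`; so it
vanishes in `c lam`. -/
theorem IsExpansion.finite_coeff_ne_zero {f : XSeries N} {c : PartitionOfLength N → ASeries}
    (hc : IsExpansion c f) (hf : HasBoundedDegreeX f) :
    ∀ β : ℤ →₀ ℕ, {lam : PartitionOfLength N | (c lam).coeff β ≠ 0}.Finite := by
  classical
  suffices H : ∀ (n : ℕ) (β : ℤ →₀ ℕ), β.degree = n →
      {lam : PartitionOfLength N | (c lam).coeff β ≠ 0}.Finite from fun β => H _ β rfl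
  intro n
  induction n using Nat.strong_induction_on with
  | _ n ih =>
    intro β hβ
    have hdeg : ∀ p ∈ antidiagonal β, p.1.degree + p.2.degree = β.degree := fun p hp => by
      rw [← map_add, mem_antidiagonal.1 hp]
    have hzero : ∀ p ∈ antidiagonal β, p.2.degree = 0 → p.1 = β := fun p hp h => by
      rw [← mem_antidiagonal.1 hp, (Finsupp.degree_eq_zero_iff _).1 h, add_zero]
    have hB : (⋃ p ∈ (antidiagonal β).filter fun p => p.1 ≠ β,
        {lam : PartitionOfLength N | (c lam).coeff p.1 ≠ 0}).Finite := by
      refine (finite_toSet _).biUnion fun p hp => ?_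
      obtain ⟨hp1, hp2⟩ := mem_filter.1 (mem_coe.1 hp)
      have h1 := hdeg p hp1
      have h2 : p.2.degree ≠ 0 := fun h => hp2 (hzero p hp1 h)
      exact ih _ (by omega) p.1 rfl
    -- `D` bounds the size of every partition whose coefficient involves a proper divisor of `a^β`.
    obtain ⟨D, hD⟩ := (hB.image fun lam => lam.1.card).bddAbove
    obtain ⟨d, hd⟩ := hf β
    have key : ∀ (m : ℕ) (lam : PartitionOfLength N), rowSum lam.1 = m →
        max d (D + β.degree) < lam.1.card → (c lam).coeff β = 0 := by
      intro m
      induction m using Nat.strong_induction_on with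
      | _ m ihm =>
        intro lam hm hlam
        have h1 : (f.coeff (rowExp lam)).coeff β = 0 := by
          by_contra hne
          have := hd _ hne
          rw [degree_rowExp] at this
          omega
        rw [(hc _).2, finsum_coeff_rowExp, map_add, map_sum] at h1
        rw [sum_eq_zero, add_zero] at h1
        · exact h1
        · intro mu hmu
          rw [mem_lowerPartitions] at hmu
          rw [MvPowerSeries.coeff_mul]
          refine sum_eq_zero fun p hp => ?_
          by_contra hne
          have h2 := degree_of_coeff_ne_zero (right_ne_zero_of_mul hne)
          have h3 := left_ne_zero_of_mul hne
          have h4 := hdeg p hp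
          have h5 : (⊥ : YoungDiagram).card = 0 := rfl
          rw [degree_rowExp] at h2
          -- If `c mu` supplies all of `a^β`, then `mu` has the size of `lam` and a smaller
          -- `rowSum`, and the inner induction applies. Otherwise `mu` has size at most `D`, so
          -- `lam` has size at most `D + β.degree`, against the choice of `lam`.
          by_cases hpβ : p.1 = β
          · rw [hpβ] at h3 h4
            exact h3 (ihm _ (hm ▸ hmu) mu rfl (by omega))
          · have h6 : mu.1.card ≤ D :=
              hD ⟨mu, Set.mem_biUnion (mem_coe.2 (mem_filter.2 ⟨hp, hpβ⟩)) h3, rfl⟩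
            omega
    refine (finite_partition_card_le N (max d (D + β.degree))).subset fun lam hlam => ?_
    by_contra hgt
    exact hlam (key _ lam rfl (not_le.1 hgt))

end EdgeSchur

end

open EdgeSchur in
/-- Throughout, `N` is the number of variables `x`, finite or `⊤`. -/
theorem mainTheorem1 (N : ℕ∞) :
    -- the generating series are well defined: each weight occurs finitely often
    (∀ (lam mu : YoungDiagram) (α : Alphabet N →₀ ℕ) (β : ℤ →₀ ℕ),
      (tableauxOfWeight (σ := Alphabet N) lam mu α β).Finite) ∧
    -- the (skew) edge Schur functions are symmetric functions
    (∀ lam mu : YoungDiagram,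
      IsSymmetricX (edgeSchur N lam mu) ∧ HasBoundedDegreeX (edgeSchur N lam mu)) ∧
    -- `E^{lam/mu} = s_{lam/mu} +` terms of higher order, both in `x` and in `a`
    (∀ lam mu : YoungDiagram, mu ≤ lam → ∃ H : XSeries N,
      edgeSchur N lam mu = MvPowerSeries.map MvPowerSeries.C (skewSchur N lam mu) + H ∧
      ∀ (α : Alphabet N →₀ ℕ) (β : ℤ →₀ ℕ), (H.coeff α).coeff β ≠ 0 →
        0 < β.degree ∧ α.degree + mu.card = lam.card + β.degree) ∧
    -- the family `E^lam` is locally finite, so that every family of coefficients can be summed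
    (∀ α : Alphabet N →₀ ℕ,
      {lam : PartitionOfLength N | (edgeSchur N lam.1 ⊥).coeff α ≠ 0}.Finite) ∧
    -- it is a basis of the completed ring of symmetric functions over `ℤ⟦a⟧`
    (∀ f : XSeries N, IsSymmetricX f →
      ∃! c : PartitionOfLength N → ASeries, IsExpansion c f) ∧
    -- and it is a basis of the completion `Λ⟦a⟧`: the elements of `Λ⟦a⟧` are those whose expansion
    -- involves each monomial `a ^ β` in only finitely many coefficients
    (∀ (f : XSeries N) (c : PartitionOfLength N → ASeries), IsExpansion c f →
      (HasBoundedDegreeX f ↔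
        ∀ β : ℤ →₀ ℕ, {lam : PartitionOfLength N | (c lam).coeff β ≠ 0}.Finite)) := by
  refine ⟨fun lam mu α β => finite_tableauxOfWeight lam mu α β,
    fun lam mu => ⟨isSymmetricX_edgeSchur N lam mu, hasBoundedDegreeX_edgeSchur N lam mu⟩,
    fun lam mu _ => edgeSchur_eq_skewSchur_add N lam mu,
    fun α => finite_coeff_ne_zero α,
    fun f hf => ⟨expansionCoeff f, isExpansion_expansionCoeff hf, fun c hc =>
      hc.unique (isExpansion_expansionCoeff hf)⟩,
    fun f c hc => ⟨hc.finite_coeff_ne_zero, hc.hasBoundedDegreeX⟩⟩
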